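/- Let $F$ be a compact oriented surface (possibly with boundary, not necessarily connected), $\pi=H_1(F;\mathbf F_2)$, and $(X,x_0)$ a pointed CW complex of type $K(\pi,1)$ with a fixed identification $\pi_1(X,x_0)=\pi$. Let $D$ be an oriented link diagram on $F$ with $n$ ordered crossings, of which $n_-$ are negative, and let $D^!$ be the diagram obtained from $D$ by switching every crossing. Let $R$ be a commutative ring and $(A,\tau)$ an unoriented $(1+1)$-dimensional homotopy quantum field theory (HQFT) over $R$ with target $X$ (for instance, but not necessarily, one that respects the S, T and 4-Tu relations). For $\varepsilon\in\{0,1\}^n$ let $D_\varepsilon$ be the smoothing of $D$ in which the $i$-th crossing is $\varepsilon_i$-smoothed. If $\varepsilon'$ arises from $\varepsilon$ by changing one entry from $0$ to $1$, let $\Sigma_{\varepsilon\to\varepsilon'}\subset F\times[0,1]$ be the surface obtained from $D_\varepsilon\times[0,1]$ by inserting a saddle at the crossing in question, a cobordism from $D_\varepsilon$ to $D_{\varepsilon'}$, and let $l(\varepsilon,\varepsilon')$ be the number of $1$'s of $\varepsilon$ in front of that entry. The curves $D_\varepsilon$ and the surfaces $\Sigma_{\varepsilon\to\varepsilon'}$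 become $X$-manifolds and $X$-cobordisms by the choice of a base point on each circle of each smoothing and of a continuous map $c\colon F\to X$ that sends these base points to $x_0$ and every loop in $F$ whose base point is sent to $x_0$ to a loop representing its class in $H_1(F;\mathbf F_2)=\pi_1(X,x_0)$; their characteristic maps are the restrictions of $c$, respectively of $F\times[0,1]\to F\xrightarrow{c}X$. Since $D^!_{\bar\varepsilon}=D_\varepsilon$ for $\bar\varepsilon=(1-\varepsilon_1,\dots,1-\varepsilon_n)$, the same choices, and the same order of the crossings, are used for $D$ and $D^!$. Let $C_{(A,\tau)}^*(F,D)$ be the complex $$C_{(A,\tau)}^i(F,D)=\bigoplus_{|\varepsilon|=i+n_-}A(D_\varepsilon),\qquad |\varepsilon|=\varepsilon_1+\dots+\varepsilon_n,$$ whose differential $d^i\colon C^i\to C^{i+1}$ has the matrix entries $(-1)^{l(\varepsilon,\varepsilon')}\tau(\Sigma_{\varepsilon\to\varepsilon'})$ (and $0$ if $\varepsilon'$ does not arise from $\varepsilon$ in this way). The dual of a complex $(C^*,d^*)$ of $R$-modules has $\operatorname{Hom}_R(C^{-i},R)$ in degree $i$, with differential $\operatorname{Hom}_R(C^{-i},R)\to\operatorname{Hom}_R(C^{-i-1},R)$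 the transpose of $d^{-i-1}$. Then there is an isomorphism of complexes from $C_{(A,\tau)}^*(F,D)$ to the dual of $C_{(A,\tau)}^*(F,D^!)$. It can be chosen so that on each summand $A(D_\varepsilon)=A(D^!_{\bar\varepsilon})$ it is, up to a sign depending only on $\varepsilon$, the map $A(D_\varepsilon)\to\operatorname{Hom}_R(A(D^!_{\bar\varepsilon}),R)$, $v\mapsto\eta(v\otimes\cdot)$, where $\eta\colon A(D_\varepsilon)\otimes A(D_\varepsilon)\to R$ is the Frobenius pairing, that is, the value of $\tau$ on the cylinder $D_\varepsilon\times[0,1]$ regarded as a cobordism from $D_\varepsilon\sqcup D_\varepsilon$ to $\emptyset$. -/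

import Mathlib

open Topology unitInterval

/-! ### Curves and surfaces -/

/-- Every point has a neighbourhood homeomorphic to an open subset of the line. -/
def IsCurve (M : Type) [TopologicalSpace M] : Prop :=
  ∀ p : M, ∃ e : OpenPartialHomeomorph M ℝ, p ∈ e.source

/-- The closed upper half plane. -/
abbrev HalfPlane : Type := {z : ℝ × ℝ // 0 ≤ z.2}

/-- `p` has a neighbourhood homeomorphic to an open subset of the closed half plane, in which `B`
corresponds to the boundary line. -/
def IsSurfaceAt (W : Type) [TopologicalSpace W] (B : Set W) (p : W) : Prop :=
  ∃ e : OpenPartialHomeomorph W HalfPlane,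
    p ∈ e.source ∧ ∀ q ∈ e.source, (q ∈ B ↔ (e q).1.2 = 0)

/-- `W` is locally a surface with boundary, and its boundary is `B`. -/
def IsSurface (W : Type) [TopologicalSpace W] (B : Set W) : Prop :=
  ∀ p : W, IsSurfaceAt W B p

theorem IsCurve.sum {M N : Type} [TopologicalSpace M] [TopologicalSpace N]
    (hM : IsCurve M) (hN : IsCurve N) : IsCurve (M ⊕ N) := by
  rintro (p | p)
  · obtain ⟨e, he⟩ := hM p
    refine ⟨e.lift_openEmbedding IsOpenEmbedding.inl, ?_⟩
    rw [OpenPartialHomeomorph.lift_openEmbedding_source]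
    exact ⟨p, he, rfl⟩
  · obtain ⟨e, he⟩ := hN p
    refine ⟨e.lift_openEmbedding IsOpenEmbedding.inr, ?_⟩
    rw [OpenPartialHomeomorph.lift_openEmbedding_source]
    exact ⟨p, he, rfl⟩

theorem IsSurfaceAt.of_openEmbedding {V W : Type} [TopologicalSpace V] [TopologicalSpace W]
    {f : V → W} (hf : IsOpenEmbedding f) {B : Set V} {C : Set W}
    (hBC : ∀ v, v ∈ B ↔ f v ∈ C) {v : V} (h : IsSurfaceAt V B v) : IsSurfaceAt W C (f v) := by
  obtain ⟨e, he, heB⟩ := h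
  have : Nonempty HalfPlane := ⟨⟨(0, 0), le_refl _⟩⟩
  refine ⟨e.lift_openEmbedding hf, ?_, ?_⟩
  · rw [OpenPartialHomeomorph.lift_openEmbedding_source]
    exact ⟨v, he, rfl⟩
  · rw [OpenPartialHomeomorph.lift_openEmbedding_source]
    rintro _ ⟨q, hq, rfl⟩
    rw [OpenPartialHomeomorph.lift_openEmbedding_apply, ← hBC]
    exact heB q hq

/-- A chart in the plane that avoids `B` suffices. -/
theorem IsSurfaceAt.of_plane {W : Type} [TopologicalSpace W] {B : Set W} {p : W}
    (e : OpenPartialHomeomorph W (ℝ × ℝ)) (hp : p ∈ e.source) (hB : ∀ q ∈ e.source, q ∉ B) :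
    IsSurfaceAt W B p := by
  have hf : IsOpenEmbedding (fun z : ℝ × ℝ => (⟨(z.1, Real.exp z.2), (Real.exp_pos _).le⟩ :
      HalfPlane)) := by
    have h1 : IsOpenEmbedding (fun z : ℝ × ℝ => ((z.1, Real.exp z.2) : ℝ × ℝ)) :=
      IsOpenEmbedding.id.prodMap Real.isOpenEmbedding_exp
    refine ⟨⟨IsInducing.subtypeVal.of_comp_iff.1 h1.1.1, ?_⟩, ?_⟩
    · intro a b h
      exact h1.injective (congrArg Subtype.val h)
    · have := h1.isOpen_range.preimage (continuous_subtype_val (p := fun z : ℝ × ℝ => 0 ≤ z.2))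
      convert this using 1
      ext ⟨z, hz⟩
      simp [Subtype.ext_iff]
  have : Nonempty (ℝ × ℝ) := ⟨(0, 0)⟩
  refine ⟨e.trans (hf.toOpenPartialHomeomorph _), by simpa using hp, ?_⟩
  intro q hq
  have hq' : q ∈ e.source := by simpa using hq
  simp [hB q hq', (Real.exp_pos _).ne']

/-- The cylinder over a curve is a surface with the two ends as boundary. -/
theorem IsCurve.prod_I {M : Type} [TopologicalSpace M] (hM : IsCurve M) :
    IsSurface (M × I) {x | x.2 = 0 ∨ x.2 = 1} := by
  rintro ⟨p, t⟩
  obtain ⟨e, he⟩ := hM p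
  have key : ∀ s : I, s < 1 → IsSurfaceAt (M × I) {x | x.2 = 0 ∨ x.2 = 1} (p, s) := by
    intro s hs
    refine ⟨{ toFun := fun x => ⟨(e x.1, (x.2 : ℝ)), x.2.2.1⟩
              invFun := fun z => (e.symm z.1.1, Set.projIcc 0 1 zero_le_one z.1.2)
              source := {x | x.1 ∈ e.source ∧ x.2 < 1}
              target := {z | z.1.1 ∈ e.target ∧ z.1.2 < 1}
              map_source' := ?_
              map_target' := ?_
              left_inv' := ?_
              right_inv' := ?_
              continuousOn_toFun := ?_
              continuousOn_invFun := ?_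
              open_source := ?_
              open_target := ?_ }, ⟨he, hs⟩, ?_⟩
    · rintro ⟨x, u⟩ ⟨h1, h2⟩
      exact ⟨e.map_source h1, h2⟩
    · rintro ⟨⟨a, b⟩, hb⟩ ⟨h1, h2⟩
      refine ⟨e.map_target h1, ?_⟩
      simp only at hb h2 ⊢
      rw [Set.projIcc_of_mem zero_le_one ⟨hb, h2.le⟩]
      exact h2
    · rintro ⟨x, u⟩ ⟨h1, h2⟩
      ext
      · simp [e.left_inv h1]
      · simp
    · rintro ⟨⟨a, b⟩, hb⟩ ⟨h1, h2⟩
      simp only at hb h2 h1 ⊢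
      rw [Set.projIcc_of_mem zero_le_one ⟨hb, h2.le⟩]
      simp [e.right_inv h1]
    · refine IsInducing.subtypeVal.continuousOn_iff.2 ?_
      refine ContinuousOn.prodMk ?_ ?_
      · exact e.continuousOn.comp continuousOn_fst (fun x hx => hx.1)
      · exact (continuous_subtype_val.comp continuous_snd).continuousOn
    · refine ContinuousOn.prodMk ?_ ?_
      · exact e.continuousOn_symm.comp
          (continuous_fst.comp continuous_subtype_val).continuousOn (fun x hx => hx.1)
      · exact (continuous_projIcc.comp
          (continuous_snd.comp continuous_subtype_val)).continuousOn
    · exact (e.open_source.preimage continuous_fst).inter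
        ((isOpen_Iio (a := (1 : I))).preimage continuous_snd)
    · exact (e.open_target.preimage (continuous_fst.comp continuous_subtype_val)).inter
        ((isOpen_Iio (a := (1 : ℝ))).preimage (continuous_snd.comp continuous_subtype_val))
    · rintro ⟨x, u⟩ ⟨h1, h2⟩
      have hu : u ≠ 1 := ne_of_lt h2
      change u = 0 ∨ u = 1 ↔ (u : ℝ) = 0
      simp [hu]
  rcases lt_or_eq_of_le (unitInterval.le_one' (t := t)) with h | h
  · exact key t h
  · subst h
    have h0 := key 0 (by simp)
    have := h0.of_openEmbedding
      ((Homeomorph.refl M).prodCongr unitInterval.symmHomeomorph).isOpenEmbedding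
      (C := {x | x.2 = 0 ∨ x.2 = 1}) (by
        rintro ⟨x, u⟩
        simp [or_comm])
    simpa using this

theorem IsSurface.sum {M N : Type} [TopologicalSpace M] [TopologicalSpace N] {B : Set M} {C : Set N}
    (hM : IsSurface M B) (hN : IsSurface N C) : IsSurface (M ⊕ N) (Sum.inl '' B ∪ Sum.inr '' C) := by
  rintro (p | p)
  · exact (hM p).of_openEmbedding IsOpenEmbedding.inl (by simp)
  · exact (hN p).of_openEmbedding IsOpenEmbedding.inr (by simp)

theorem connectedComponent_inl {M N : Type} [TopologicalSpace M] [TopologicalSpace N] (p : M) :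
    connectedComponent (Sum.inl p : M ⊕ N) = Sum.inl '' connectedComponent p := by
  apply Set.Subset.antisymm
  · have h1 : connectedComponent (Sum.inl p : M ⊕ N) ⊆ Set.range Sum.inl :=
      isClopen_range_inl.connectedComponent_subset ⟨p, rfl⟩
    have h2 : IsPreconnected (Sum.inl ⁻¹' connectedComponent (Sum.inl p : M ⊕ N) : Set M) :=
      isPreconnected_connectedComponent.preimage_of_isOpenMap Sum.inl_injective isOpenMap_inl h1
    intro x hx
    obtain ⟨y, rfl⟩ := h1 hx
    exact ⟨y, h2.subset_connectedComponent (by exact mem_connectedComponent) hx, rfl⟩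
  · exact (isPreconnected_connectedComponent.image _ continuous_inl.continuousOn).subset_connectedComponent
      ⟨p, mem_connectedComponent, rfl⟩

theorem connectedComponent_inr {M N : Type} [TopologicalSpace M] [TopologicalSpace N] (p : N) :
    connectedComponent (Sum.inr p : M ⊕ N) = Sum.inr '' connectedComponent p := by
  apply Set.Subset.antisymm
  · have h1 : connectedComponent (Sum.inr p : M ⊕ N) ⊆ Set.range Sum.inr :=
      isClopen_range_inr.connectedComponent_subset ⟨p, rfl⟩
    have h2 : IsPreconnected (Sum.inr ⁻¹' connectedComponent (Sum.inr p : M ⊕ N) : Set N) :=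
      isPreconnected_connectedComponent.preimage_of_isOpenMap Sum.inr_injective isOpenMap_inr h1
    intro x hx
    obtain ⟨y, rfl⟩ := h1 hx
    exact ⟨y, h2.subset_connectedComponent (by exact mem_connectedComponent) hx, rfl⟩
  · exact (isPreconnected_connectedComponent.image _ continuous_inr.continuousOn).subset_connectedComponent
      ⟨p, mem_connectedComponent, rfl⟩

/-! ### The model smoothings and the model saddle -/

/-- The two smoothings of the crossing `|x| = |y|` of the plane: `true` is the pair of curves
`x = max |y| 1` and `x = -max |y| 1`, and `false` the pair `y = max |x| 1` and `y = -max |x| 1`. -/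
def smoothingModel : Bool → Set (ℝ × ℝ)
  | true => {z | |z.1| = max |z.2| 1}
  | false => {z | |z.2| = max |z.1| 1}

/-- The saddle in the product of the plane with `[0,1]`, which goes from the smoothing `b` at time `0`
to the other smoothing at time `1` and passes through the crossing at time `1/2`. -/
def saddleModel : Bool → Set ((ℝ × ℝ) × I)
  | true => {w | max |w.1.2| (1 - 2 * (w.2 : ℝ)) = max |w.1.1| (2 * (w.2 : ℝ) - 1)}
  | false => {w | max |w.1.1| (1 - 2 * (w.2 : ℝ)) = max |w.1.2| (2 * (w.2 : ℝ) - 1)}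

theorem saddleModel_zero (b : Bool) (z : ℝ × ℝ) :
    (z, (0 : I)) ∈ saddleModel b ↔ z ∈ smoothingModel b := by
  have h1 : max |z.1| (-1) = |z.1| := max_eq_left (by linarith [abs_nonneg z.1])
  have h2 : max |z.2| (-1) = |z.2| := max_eq_left (by linarith [abs_nonneg z.2])
  cases b <;> simp [saddleModel, smoothingModel, h1, h2, eq_comm]

theorem saddleModel_one (b : Bool) (z : ℝ × ℝ) :
    (z, (1 : I)) ∈ saddleModel b ↔ z ∈ smoothingModel (!b) := by
  have h1 : max |z.1| (1 - 2) = |z.1| := max_eq_left (by linarith [abs_nonneg z.1])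
  have h2 : max |z.2| (1 - 2) = |z.2| := max_eq_left (by linarith [abs_nonneg z.2])
  have h3 : (2 : ℝ) - 1 = 1 := by norm_num
  cases b <;> simp [saddleModel, smoothingModel, h1, h2, h3]

/-- The square `[-1,1]²`. -/
def square : Set (ℝ × ℝ) := {z | |z.1| ≤ 1 ∧ |z.2| ≤ 1}

theorem smoothingModel_off (b : Bool) {z : ℝ × ℝ} (hz : z ∉ square) :
    z ∈ smoothingModel b ↔ |z.1| = |z.2| := by
  have hz : ¬ (|z.1| ≤ 1 ∧ |z.2| ≤ 1) := hz
  cases b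
  · change |z.2| = max |z.1| 1 ↔ |z.1| = |z.2|
    grind
  · change |z.1| = max |z.2| 1 ↔ |z.1| = |z.2|
    grind

theorem saddleModel_off (b : Bool) {z : ℝ × ℝ} (t : I) (hz : z ∉ square) :
    (z, t) ∈ saddleModel b ↔ |z.1| = |z.2| := by
  have hz : ¬ (|z.1| ≤ 1 ∧ |z.2| ≤ 1) := hz
  have h0 : 0 ≤ (t : ℝ) := t.2.1
  have h1 : (t : ℝ) ≤ 1 := t.2.2
  cases b
  · change max |z.1| (1 - 2 * (t : ℝ)) = max |z.2| (2 * (t : ℝ) - 1) ↔ _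
    grind
  · change max |z.2| (1 - 2 * (t : ℝ)) = max |z.1| (2 * (t : ℝ) - 1) ↔ _
    grind

theorem isClosed_smoothingModel (b : Bool) : IsClosed (smoothingModel b) := by
  cases b <;> exact isClosed_eq (by fun_prop) (by fun_prop)

theorem isClosed_saddleModel (b : Bool) : IsClosed (saddleModel b) := by
  cases b <;> exact isClosed_eq (by fun_prop) (by fun_prop)

theorem sign_mul_eq {s y m : ℝ} (hs : |s| = 1) (hy : 0 < s * y) (h : |y| = m) : s * m = y := by
  rcases eq_or_eq_neg_of_abs_eq hs with rfl | rfl <;> rcases abs_cases y with h1 | h1 <;> linarith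

theorem isCurve_smoothingModel_false : IsCurve (smoothingModel false) := by
  have key : ∀ s : ℝ, |s| = 1 → ∀ z : smoothingModel false, 0 < s * z.1.2 →
      ∃ e : OpenPartialHomeomorph (smoothingModel false) ℝ, z ∈ e.source := by
    intro s hs z hz
    refine ⟨{ toFun := fun w => w.1.1
              invFun := fun x => ⟨(x, s * max |x| 1), by
                simp [smoothingModel, abs_mul, hs, abs_of_pos]⟩
              source := {w | 0 < s * w.1.2}
              target := Set.univ
              map_source' := fun _ _ => trivial
              map_target' := ?_
              left_inv' := ?_
              right_inv' := fun _ _ => rfl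
              continuousOn_toFun := by fun_prop
              continuousOn_invFun := by fun_prop
              open_source := isOpen_lt (by fun_prop) (by fun_prop)
              open_target := isOpen_univ }, hz⟩
    · intro x _
      have h1 : s * s = 1 := by rw [← abs_mul_abs_self, hs, mul_one]
      have h2 : 0 < max |x| 1 := by positivity
      change 0 < s * (s * max |x| 1)
      rwa [← mul_assoc, h1, one_mul]
    · rintro ⟨⟨x, y⟩, hxy⟩ hw
      ext
      · rfl
      · exact sign_mul_eq hs hw hxy
  intro z
  have hz : |z.1.2| = max |z.1.1| 1 := z.2
  rcases lt_trichotomy z.1.2 0 with h | h | h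
  · exact key (-1) (by simp) z (by linarith)
  · exfalso
    rw [h, abs_zero] at hz
    linarith [le_max_right |z.1.1| 1]
  · exact key 1 (by simp) z (by linarith)

theorem IsCurve.of_homeomorph {M N : Type} [TopologicalSpace M] [TopologicalSpace N]
    (e : M ≃ₜ N) (hM : IsCurve M) : IsCurve N := by
  intro p
  obtain ⟨c, hc⟩ := hM (e.symm p)
  exact ⟨e.symm.toOpenPartialHomeomorph.trans c, by simpa using hc⟩

theorem isCurve_smoothingModel (b : Bool) : IsCurve (smoothingModel b) := by
  cases b
  · exact isCurve_smoothingModel_false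
  · exact isCurve_smoothingModel_false.of_homeomorph
      ((Homeomorph.prodComm ℝ ℝ).subtype (fun z => Iff.rfl))

/-- Charts of the saddle before the time `1/2`. -/
theorem saddle_bottom (w : saddleModel false) (hw : (w.1.2 : ℝ) < 1 / 2) :
    IsSurfaceAt (saddleModel false) {w | w.1.2 = 0 ∨ w.1.2 = 1} w := by
  have key : ∀ s : ℝ, |s| = 1 → ∀ w : saddleModel false, (w.1.2 : ℝ) < 1 / 2 → 0 < s * w.1.1.2 →
      IsSurfaceAt (saddleModel false) {w | w.1.2 = 0 ∨ w.1.2 = 1} w := by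
    intro s hs w hw hy
    have hss : s * s = 1 := by rw [← abs_mul_abs_self, hs, mul_one]
    refine ⟨{ toFun := fun w => ⟨(w.1.1.1, (w.1.2 : ℝ)), w.1.2.2.1⟩
              invFun := fun z => ⟨((z.1.1, s * max |z.1.1| (1 - 2 * (min z.1.2 (1/2)))),
                ⟨min z.1.2 (1/2), le_min z.2 (by norm_num),
                  (min_le_right _ _).trans (by norm_num)⟩), by
                  have h1 : min z.1.2 (1/2) ≤ 1/2 := min_le_right _ _
                  change max |z.1.1| (1 - 2 * (min z.1.2 (1/2))) =
                    max |s * max |z.1.1| (1 - 2 * (min z.1.2 (1/2)))| (2 * (min z.1.2 (1/2)) - 1)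
                  have h2 : 0 ≤ max |z.1.1| (1 - 2 * (min z.1.2 (1/2))) :=
                    (abs_nonneg _).trans (le_max_left _ _)
                  rw [abs_mul, hs, one_mul, abs_of_nonneg h2, max_eq_left (a := max |z.1.1| _)
                    (le_trans (by linarith) h2)]⟩
              source := {w | (w.1.2 : ℝ) < 1 / 2 ∧ 0 < s * w.1.1.2}
              target := {z | z.1.2 < 1 / 2}
              map_source' := fun w hw => hw.1
              map_target' := ?_
              left_inv' := ?_
              right_inv' := ?_
              continuousOn_toFun := ?_
              continuousOn_invFun := ?_
              open_source := ?_
              open_target := ?_ }, ⟨hw, hy⟩, ?_⟩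
    · rintro ⟨⟨x, t⟩, ht0⟩ ht
      have ht : t < 1 / 2 := ht
      change min t (1/2) < 1/2 ∧ 0 < s * (s * max |x| (1 - 2 * min t (1/2)))
      rw [min_eq_left ht.le, ← mul_assoc, hss, one_mul]
      exact ⟨ht, lt_max_of_lt_right (by linarith)⟩
    · rintro ⟨⟨⟨x, y⟩, t⟩, hxy⟩ ⟨h1, h2⟩
      have h1 : (t : ℝ) < 1/2 := h1
      have h2 : 0 < s * y := h2
      have h3 : max |x| (1 - 2 * (t : ℝ)) = max |y| (2 * (t : ℝ) - 1) := hxy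
      rw [max_eq_left (a := |y|) (by linarith [abs_nonneg y])] at h3
      ext
      · rfl
      · change s * max |x| (1 - 2 * min (t : ℝ) (1/2)) = y
        rw [min_eq_left h1.le]
        exact sign_mul_eq hs h2 h3.symm
      · exact min_eq_left h1.le
    · rintro ⟨⟨x, t⟩, ht0⟩ ht
      ext
      · rfl
      · exact min_eq_left (le_of_lt ht)
    · fun_prop
    · fun_prop
    · have h1 : IsOpen {w : saddleModel false | (w.1.2 : ℝ) < 1 / 2} :=
        isOpen_lt (by fun_prop) (by fun_prop)
      have h2 : IsOpen {w : saddleModel false | 0 < s * w.1.1.2} :=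
        isOpen_lt (by fun_prop) (by fun_prop)
      exact h1.inter h2
    · exact isOpen_lt (by fun_prop) (by fun_prop)
    · rintro ⟨⟨⟨x, y⟩, t⟩, hxy⟩ ⟨h1, h2⟩
      have h1 : (t : ℝ) < 1/2 := h1
      change t = 0 ∨ t = 1 ↔ (t : ℝ) = 0
      have h3 : t ≠ 1 := by
        rintro rfl
        norm_num at h1
      simp [h3]
  have hz : max |w.1.1.1| (1 - 2 * (w.1.2 : ℝ)) = max |w.1.1.2| (2 * (w.1.2 : ℝ) - 1) := w.2
  rcases lt_trichotomy w.1.1.2 0 with h | h | h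
  · exact key (-1) (by simp) w hw (by linarith)
  · exfalso
    rw [h, abs_zero, max_eq_left (a := (0 : ℝ)) (by linarith)] at hz
    linarith [le_max_right |w.1.1.1| (1 - 2 * (w.1.2 : ℝ))]
  · exact key 1 (by simp) w hw (by linarith)

theorem saddle_abs_forward (x y u : ℝ) (h : max |x| (-u) = max |y| u) :
    |x + max (-(|y| + u)) (min (2 * x) (|y| + u))| = |x| + |y| + u := by
  rcases abs_cases x with ⟨hx, hx'⟩ | ⟨hx, hx'⟩ <;>
    rcases abs_cases y with ⟨hy, hy'⟩ | ⟨hy, hy'⟩ <;> rw [hx, hy] at * <;> grind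

theorem saddle_left_inv (x y u : ℝ) (h : max |x| (-u) = max |y| u) :
    max (-(max ((|x| + |y|) / 2) u))
      (min (x + max (-(|y| + u)) (min (2 * x) (|y| + u))) (max ((|x| + |y|) / 2) u)) = x := by
  have hx0 := abs_nonneg x
  have hy0 := abs_nonneg y
  have hx : x = |x| ∨ x = -|x| := by
    rcases abs_cases x with h | h
    · left; linarith
    · right; linarith
  generalize |x| = a at *
  generalize |y| = b at *
  rcases lt_trichotomy a b with h1 | h1 | h1
  · have hu : u = -b := by grind
    subst hu
    rcases hx with rfl | rfl <;> grind
  · subst h1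
    have h2 : u ≤ a := by grind
    have h3 : -a ≤ u := by grind
    rw [max_eq_left (a := (a + a) / 2) (by linarith)]
    rcases hx with rfl | rfl <;> grind
  · have hu : u = a := by grind
    subst hu
    rcases hx with rfl | rfl <;> grind

theorem saddle_abs_backward (p a b : ℝ) (ha : a = |p|) (hb : 0 ≤ b) :
    |max (-(max ((a + b) / 4) ((a - b) / 2))) (min p (max ((a + b) / 4) ((a - b) / 2)))| =
      min a (max ((a + b) / 4) ((a - b) / 2)) := by
  grind

theorem saddle_right_inv (p a b : ℝ) (ha : a = |p|) (hb : 0 ≤ b) :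
    max (-(max ((a + b) / 4) ((a - b) / 2))) (min p (max ((a + b) / 4) ((a - b) / 2))) +
      max (-(min b (max ((b + a) / 4) ((b - a) / 2)) + (a - b) / 2))
        (min (2 * max (-(max ((a + b) / 4) ((a - b) / 2)))
          (min p (max ((a + b) / 4) ((a - b) / 2))))
          (min b (max ((b + a) / 4) ((b - a) / 2)) + (a - b) / 2)) = p := by
  have h0 : 0 ≤ a := ha ▸ abs_nonneg p
  have hp : p = a ∨ p = -a := by
    rcases abs_cases p with h | h
    · left; linarith
    · right; linarith
  clear ha
  rcases le_total b (3 * a) with h1 | h1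
  · rcases le_total a (3 * b) with h2 | h2
    · rw [max_eq_left (a := (a + b) / 4) (by linarith),
        max_eq_left (a := (b + a) / 4) (by linarith), min_eq_right (a := b) (by linarith)]
      rcases hp with rfl | rfl <;> grind
    · rw [max_eq_right (a := (a + b) / 4) (by linarith),
        max_eq_left (a := (b + a) / 4) (by linarith), min_eq_left (a := b) (by linarith)]
      rcases hp with rfl | rfl <;> grind
  · rw [max_eq_left (a := (a + b) / 4) (by linarith),
      max_eq_right (a := (b + a) / 4) (by linarith), min_eq_right (a := b) (by linarith)]
    rcases hp with rfl | rfl <;> grind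

theorem saddle_mem (a b : ℝ) (ha : 0 ≤ a) (hb : 0 ≤ b) :
    max (min a (max ((a + b) / 4) ((a - b) / 2))) (-((a - b) / 2)) =
      max (min b (max ((b + a) / 4) ((b - a) / 2))) ((a - b) / 2) := by
  grind

/-- The image of the interior of the saddle in the plane under its global chart. -/
def saddleTarget : Set (ℝ × ℝ) := {z | -1 < (|z.1| - |z.2|) / 2 ∧ (|z.1| - |z.2|) / 2 < 1}

/-- The inverse of the global chart of the interior of the saddle. -/
noncomputable def saddleInv (z : saddleTarget) : saddleModel false :=
  ⟨((max (-(max ((|z.1.1| + |z.1.2|) / 4) ((|z.1.1| - |z.1.2|) / 2)))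
        (min z.1.1 (max ((|z.1.1| + |z.1.2|) / 4) ((|z.1.1| - |z.1.2|) / 2))),
      max (-(max ((|z.1.2| + |z.1.1|) / 4) ((|z.1.2| - |z.1.1|) / 2)))
        (min z.1.2 (max ((|z.1.2| + |z.1.1|) / 4) ((|z.1.2| - |z.1.1|) / 2)))),
      ⟨(1 + (|z.1.1| - |z.1.2|) / 2) / 2, by linarith [z.2.1], by linarith [z.2.2]⟩), by
    have h := saddle_mem |z.1.1| |z.1.2| (abs_nonneg _) (abs_nonneg _)
    rw [← saddle_abs_backward z.1.1 _ _ rfl (abs_nonneg _),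
      ← saddle_abs_backward z.1.2 _ _ rfl (abs_nonneg _)] at h
    have e1 : 1 - 2 * ((1 + (|z.1.1| - |z.1.2|) / 2) / 2) = -((|z.1.1| - |z.1.2|) / 2) := by ring
    have e2 : 2 * ((1 + (|z.1.1| - |z.1.2|) / 2) / 2) - 1 = (|z.1.1| - |z.1.2|) / 2 := by ring
    simp only [saddleModel, Set.mem_ofPred_eq]
    rw [e1, e2]
    exact h⟩

theorem continuous_saddleInv : Continuous saddleInv := by
  unfold saddleInv
  fun_prop

theorem saddle_interior (w : saddleModel false) (h0 : 0 < (w.1.2 : ℝ)) (h1 : (w.1.2 : ℝ) < 1) :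
    IsSurfaceAt (saddleModel false) {w | w.1.2 = 0 ∨ w.1.2 = 1} w := by
  classical
  have hmem : ∀ w : saddleModel false, max |w.1.1.1| (-(2 * (w.1.2 : ℝ) - 1)) =
      max |w.1.1.2| (2 * (w.1.2 : ℝ) - 1) := by
    intro w
    rw [neg_sub]
    exact w.2
  have hmem' : ∀ w : saddleModel false, max |w.1.1.2| (-(-(2 * (w.1.2 : ℝ) - 1))) =
      max |w.1.1.1| (-(2 * (w.1.2 : ℝ) - 1)) := by
    intro w
    rw [neg_neg]
    exact (hmem w).symm
  have hP : ∀ w : saddleModel false,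
      |w.1.1.1 + max (-(|w.1.1.2| + (2 * (w.1.2 : ℝ) - 1)))
        (min (2 * w.1.1.1) (|w.1.1.2| + (2 * (w.1.2 : ℝ) - 1)))| =
        |w.1.1.1| + |w.1.1.2| + (2 * (w.1.2 : ℝ) - 1) :=
    fun w => saddle_abs_forward _ _ _ (hmem w)
  have hQ : ∀ w : saddleModel false,
      |w.1.1.2 + max (-(|w.1.1.1| + -(2 * (w.1.2 : ℝ) - 1)))
        (min (2 * w.1.1.2) (|w.1.1.1| + -(2 * (w.1.2 : ℝ) - 1)))| =
        |w.1.1.2| + |w.1.1.1| + -(2 * (w.1.2 : ℝ) - 1) :=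
    fun w => saddle_abs_forward _ _ _ (hmem' w)
  refine IsSurfaceAt.of_plane
    { toFun := fun w =>
        (w.1.1.1 + max (-(|w.1.1.2| + (2 * (w.1.2 : ℝ) - 1)))
            (min (2 * w.1.1.1) (|w.1.1.2| + (2 * (w.1.2 : ℝ) - 1))),
          w.1.1.2 + max (-(|w.1.1.1| + -(2 * (w.1.2 : ℝ) - 1)))
            (min (2 * w.1.1.2) (|w.1.1.1| + -(2 * (w.1.2 : ℝ) - 1))))
      invFun := fun z => if h : z ∈ saddleTarget then saddleInv ⟨z, h⟩ else w
      source := {w | 0 < (w.1.2 : ℝ) ∧ (w.1.2 : ℝ) < 1}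
      target := saddleTarget
      map_source' := ?_
      map_target' := ?_
      left_inv' := ?_
      right_inv' := ?_
      continuousOn_toFun := by fun_prop
      continuousOn_invFun := ?_
      open_source := ?_
      open_target := ?_ } ⟨h0, h1⟩ ?_
  · rintro w ⟨h1, h2⟩
    simp only [saddleTarget, Set.mem_ofPred_eq]
    rw [hP, hQ]
    constructor <;> linarith
  · intro z hz
    rw [dif_pos hz]
    have h1 := hz.1
    have h2 := hz.2
    change 0 < (1 + (|z.1| - |z.2|) / 2) / 2 ∧ (1 + (|z.1| - |z.2|) / 2) / 2 < 1
    constructor <;> linarith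
  · rintro w ⟨h1, h2⟩
    have hz : (w.1.1.1 + max (-(|w.1.1.2| + (2 * (w.1.2 : ℝ) - 1)))
            (min (2 * w.1.1.1) (|w.1.1.2| + (2 * (w.1.2 : ℝ) - 1))),
          w.1.1.2 + max (-(|w.1.1.1| + -(2 * (w.1.2 : ℝ) - 1)))
            (min (2 * w.1.1.2) (|w.1.1.1| + -(2 * (w.1.2 : ℝ) - 1)))) ∈ saddleTarget := by
      simp only [saddleTarget, Set.mem_ofPred_eq]
      rw [hP, hQ]
      constructor <;> linarith
    rw [dif_pos hz]
    have ring1 : ∀ a b u : ℝ, (a + b + u + (b + a + -u)) / 4 = (a + b) / 2 := fun a b u => by ring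
    have ring2 : ∀ a b u : ℝ, (a + b + u - (b + a + -u)) / 2 = u := fun a b u => by ring
    have ring3 : ∀ a b u : ℝ, (a + b + -u + (b + a + u)) / 4 = (a + b) / 2 := fun a b u => by ring
    have ring4 : ∀ a b u : ℝ, (a + b + -u - (b + a + u)) / 2 = -u := fun a b u => by ring
    have l1 := saddle_left_inv _ _ _ (hmem w)
    have l2 := saddle_left_inv _ _ _ (hmem' w)
    ext
    · simp only [saddleInv]
      rw [hP, hQ]
      rw [ring1, ring2]
      exact l1
    · simp only [saddleInv]
      rw [hP, hQ]
      rw [ring3, ring4]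
      exact l2
    · simp only [saddleInv]
      rw [hP, hQ]
      ring
  · intro z hz
    rw [dif_pos hz]
    have e2 : 2 * ((1 + (|z.1| - |z.2|) / 2) / 2) - 1 = (|z.1| - |z.2|) / 2 := by ring
    have e3 : -((|z.1| - |z.2|) / 2) = (|z.2| - |z.1|) / 2 := by ring
    simp only [saddleInv]
    rw [e2, e3, saddle_abs_backward z.1 _ _ rfl (abs_nonneg _),
      saddle_abs_backward z.2 _ _ rfl (abs_nonneg _), saddle_right_inv z.1 _ _ rfl (abs_nonneg _),
      saddle_right_inv z.2 _ _ rfl (abs_nonneg _)]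
  · rw [continuousOn_iff_continuous_domRestrict]
    convert continuous_saddleInv using 1
    ext1 z
    simp [z.2]
  · have h1 : IsOpen {w : saddleModel false | 0 < (w.1.2 : ℝ)} :=
      isOpen_lt (by fun_prop) (by fun_prop)
    have h2 : IsOpen {w : saddleModel false | (w.1.2 : ℝ) < 1} :=
      isOpen_lt (by fun_prop) (by fun_prop)
    exact h1.inter h2
  · have h1 : IsOpen {z : ℝ × ℝ | -1 < (|z.1| - |z.2|) / 2} :=
      isOpen_lt (by fun_prop) (by fun_prop)
    have h2 : IsOpen {z : ℝ × ℝ | (|z.1| - |z.2|) / 2 < 1} :=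
      isOpen_lt (by fun_prop) (by fun_prop)
    exact h1.inter h2
  · rintro w ⟨h1, h2⟩ (h | h)
    · rw [h] at h1
      simp at h1
    · rw [h] at h2
      simp at h2

theorem isSurface_saddleModel_false :
    IsSurface (saddleModel false) {w | w.1.2 = 0 ∨ w.1.2 = 1} := by
  intro w
  rcases lt_or_ge (w.1.2 : ℝ) (1 / 2) with h | h
  · exact saddle_bottom w h
  rcases lt_or_ge (w.1.2 : ℝ) 1 with h1 | h1
  · exact saddle_interior w (by linarith) h1
  let e : saddleModel false ≃ₜ saddleModel false :=
    ((Homeomorph.prodComm ℝ ℝ).prodCongr unitInterval.symmHomeomorph).subtype (by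
      intro w
      have e1 : 1 - 2 * (1 - (w.2 : ℝ)) = 2 * (w.2 : ℝ) - 1 := by ring
      have e2 : 2 * (1 - (w.2 : ℝ)) - 1 = 1 - 2 * (w.2 : ℝ) := by ring
      simp [saddleModel, e1, e2, eq_comm])
  have h2 := (saddle_bottom (e w) (by
    change 1 - (w.1.2 : ℝ) < 1 / 2
    linarith)).of_openEmbedding e.symm.isOpenEmbedding (C := {w | w.1.2 = 0 ∨ w.1.2 = 1}) (by
      intro v
      change v.1.2 = 0 ∨ v.1.2 = 1 ↔ unitInterval.symm v.1.2 = 0 ∨ unitInterval.symm v.1.2 = 1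
      simp [or_comm])
  simpa using h2

theorem isSurface_saddleModel (b : Bool) :
    IsSurface (saddleModel b) {w | w.1.2 = 0 ∨ w.1.2 = 1} := by
  cases b
  · exact isSurface_saddleModel_false
  · intro w
    let e : saddleModel true ≃ₜ saddleModel false :=
      ((Homeomorph.prodComm ℝ ℝ).prodCongr (Homeomorph.refl I)).subtype (fun w => Iff.rfl)
    have h2 := (isSurface_saddleModel_false (e w)).of_openEmbedding e.symm.isOpenEmbedding
      (C := {w | w.1.2 = 0 ∨ w.1.2 = 1}) (fun v => Iff.rfl)
    simpa using h2

universe u v w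

/-! ### Pointed `X`-curves and `X`-cobordisms -/

/-- An unoriented `1`-dimensional `X`-manifold: a closed `1`-manifold with one base point on each
component and a characteristic map to `X` sending the base points to `x₀`. -/
structure XMan (X : Type u) [TopologicalSpace X] (x₀ : X) where
  carrier : Type
  [top : TopologicalSpace carrier]
  [compact : CompactSpace carrier]
  [t2 : T2Space carrier]
  isCurve : IsCurve carrier
  base : Set carrier
  base_unique : ∀ p : carrier, ∃! b, b ∈ base ∧ b ∈ connectedComponent p
  g : C(carrier, X)
  g_base : ∀ b ∈ base, g b = x₀

attribute [instance] XMan.top XMan.compact XMan.t2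

namespace XMan

variable {X : Type u} [TopologicalSpace X] {x₀ : X}

/-- The empty `X`-manifold. -/
def empty : XMan X x₀ where
  carrier := Empty
  isCurve p := p.elim
  base := ∅
  base_unique p := p.elim
  g := ⟨fun p => p.elim, continuous_of_discreteTopology⟩
  g_base p := p.elim

/-- The disjoint union of two `X`-manifolds. -/
def sum (M N : XMan X x₀) : XMan X x₀ where
  carrier := M.carrier ⊕ N.carrier
  isCurve := M.isCurve.sum N.isCurve
  base := {p | Sum.elim (fun a => a ∈ M.base) (fun b => b ∈ N.base) p}
  base_unique := by
    rintro (p | p)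
    · obtain ⟨b, hb, hu⟩ := M.base_unique p
      refine ⟨Sum.inl b, ⟨hb.1, ?_⟩, ?_⟩
      · rw [connectedComponent_inl]
        exact ⟨b, hb.2, rfl⟩
      · rintro c ⟨hc, hcp⟩
        rw [connectedComponent_inl] at hcp
        obtain ⟨c, hc', rfl⟩ := hcp
        rw [hu c ⟨hc, hc'⟩]
    · obtain ⟨b, hb, hu⟩ := N.base_unique p
      refine ⟨Sum.inr b, ⟨hb.1, ?_⟩, ?_⟩
      · rw [connectedComponent_inr]
        exact ⟨b, hb.2, rfl⟩
      · rintro c ⟨hc, hcp⟩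
        rw [connectedComponent_inr] at hcp
        obtain ⟨c, hc', rfl⟩ := hcp
        rw [hu c ⟨hc, hc'⟩]
  g := ⟨Sum.elim M.g N.g, M.g.continuous.sumElim N.g.continuous⟩
  g_base := by
    rintro (b | b) hb
    · exact M.g_base b hb
    · exact N.g_base b hb

end XMan

/-- An `X`-homeomorphism of `X`-manifolds. -/
structure XHomeo {X : Type u} [TopologicalSpace X] {x₀ : X} (M N : XMan X x₀) where
  toHomeo : M.carrier ≃ₜ N.carrier
  base_iff : ∀ p, toHomeo p ∈ N.base ↔ p ∈ M.base
  g_comp : ∀ p, N.g (toHomeo p) = M.g p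

namespace XHomeo

variable {X : Type u} [TopologicalSpace X] {x₀ : X}

/-- Composition, first `e` and then `f`. -/
def trans {M N P : XMan X x₀} (e : XHomeo M N) (f : XHomeo N P) : XHomeo M P where
  toHomeo := e.toHomeo.trans f.toHomeo
  base_iff p := (f.base_iff _).trans (e.base_iff p)
  g_comp p := (f.g_comp _).trans (e.g_comp p)

/-- The identity, between `X`-manifolds that are equal. -/
def ofEq {M N : XMan X x₀} (h : M = N) : XHomeo M N where
  toHomeo := h ▸ Homeomorph.refl M.carrier
  base_iff p := by subst h; exact Iff.rfl
  g_comp p := by subst h; rfl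

/-- The disjoint union of two `X`-homeomorphisms. -/
def sum {M N M' N' : XMan X x₀} (e : XHomeo M M') (f : XHomeo N N') :
    XHomeo (M.sum N) (M'.sum N') where
  toHomeo := e.toHomeo.sumCongr f.toHomeo
  base_iff := by
    rintro (p | p)
    · exact e.base_iff p
    · exact f.base_iff p
  g_comp := by
    rintro (p | p)
    · exact e.g_comp p
    · exact f.g_comp p

/-- The exchange of the two parts of a disjoint union. -/
def sumComm (M N : XMan X x₀) : XHomeo (M.sum N) (N.sum M) where
  toHomeo := Homeomorph.sumComm M.carrier N.carrier
  base_iff := by rintro (p | p) <;> exact Iff.rfl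
  g_comp := by rintro (p | p) <;> rfl

/-- The re-bracketing of a disjoint union of three parts. -/
def sumAssoc (M N P : XMan X x₀) : XHomeo ((M.sum N).sum P) (M.sum (N.sum P)) where
  toHomeo := Homeomorph.sumAssoc M.carrier N.carrier P.carrier
  base_iff := by rintro ((p | p) | p) <;> exact Iff.rfl
  g_comp := by rintro ((p | p) | p) <;> rfl

/-- The removal of an empty part of a disjoint union. -/
def sumEmpty (M : XMan X x₀) : XHomeo (M.sum XMan.empty) M where
  toHomeo := Homeomorph.sumEmpty M.carrier Empty
  base_iff := by
    rintro (p | p)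
    · exact Iff.rfl
    · exact p.elim
  g_comp := by
    rintro (p | p)
    · rfl
    · exact p.elim

end XHomeo

/-- An unoriented `(1+1)`-dimensional `X`-cobordism from the bottom base `M₀` to the top base `M₁`:
a compact surface with a map to `X`, whose boundary is identified with the disjoint union of `M₀`
and `M₁` compatibly with the characteristic maps. -/
structure XCob {X : Type u} [TopologicalSpace X] {x₀ : X} (M₀ M₁ : XMan X x₀) where
  carrier : Type
  [top : TopologicalSpace carrier]
  [compact : CompactSpace carrier]
  [t2 : T2Space carrier]
  bot : C(M₀.carrier, carrier)
  tp : C(M₁.carrier, carrier)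
  bd_injective : Function.Injective (Sum.elim bot tp)
  isSurface : IsSurface carrier (Set.range (Sum.elim bot tp))
  g : C(carrier, X)
  g_bot : ∀ p, g (bot p) = M₀.g p
  g_tp : ∀ p, g (tp p) = M₁.g p

attribute [instance] XCob.top XCob.compact XCob.t2

namespace XCob

variable {X : Type u} [TopologicalSpace X] {x₀ : X}

/-- The same surface with another characteristic map, unchanged on the boundary. -/
def withMap {M₀ M₁ : XMan X x₀} (W : XCob M₀ M₁) (g' : C(W.carrier, X))
    (hb : ∀ p, g' (W.bot p) = M₀.g p) (ht : ∀ p, g' (W.tp p) = M₁.g p) : XCob M₀ M₁ :=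
  { W with g := g', g_bot := hb, g_tp := ht }

/-- The cylinder `M × [0,1]` as a cobordism from `M` to `M`, with characteristic map `G`. -/
def cylinder (M : XMan X x₀) (G : C(M.carrier × I, X)) (h0 : ∀ p, G (p, 0) = M.g p)
    (h1 : ∀ p, G (p, 1) = M.g p) : XCob M M where
  carrier := M.carrier × I
  bot := ⟨fun p => (p, 0), by fun_prop⟩
  tp := ⟨fun p => (p, 1), by fun_prop⟩
  bd_injective := by rintro (p | p) (q | q) h <;> simp_all
  isSurface := by
    convert M.isCurve.prod_I using 1
    ext ⟨p, t⟩
    simp [eq_comm]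
  g := G
  g_bot := h0
  g_tp := h1

/-- The cylinder `M × [0,1]`, with characteristic map constant along `[0,1]`, as a cobordism from
`M ⊔ M` to the empty manifold. -/
def bentCylinder (M : XMan X x₀) : XCob (M.sum M) (XMan.empty : XMan X x₀) where
  carrier := M.carrier × I
  bot := ⟨Sum.elim (fun p => (p, 0)) (fun p => (p, 1)),
    Continuous.sumElim (by fun_prop) (by fun_prop)⟩
  tp := ⟨fun p => p.elim, continuous_of_discreteTopology (α := Empty)⟩
  bd_injective := by
    rintro ((p | p) | p) ((q | q) | q) h
    · rw [show p = q from congrArg Prod.fst h]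
    · exact absurd (congrArg Prod.snd h) zero_ne_one
    · exact q.elim
    · exact absurd (congrArg Prod.snd h) one_ne_zero
    · rw [show p = q from congrArg Prod.fst h]
    all_goals first | exact p.elim | exact q.elim
  isSurface := by
    convert M.isCurve.prod_I using 1
    ext ⟨p, t⟩
    constructor
    · rintro ⟨(q | q) | q, h⟩
      · exact Or.inl (congrArg Prod.snd h).symm
      · exact Or.inr (congrArg Prod.snd h).symm
      · exact q.elim
    · rintro (h | h)
      · exact ⟨Sum.inl (Sum.inl p), Prod.ext rfl h.symm⟩
      · exact ⟨Sum.inl (Sum.inr p), Prod.ext rfl h.symm⟩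
  g := M.g.comp ⟨Prod.fst, continuous_fst⟩
  g_bot := by rintro (p | p) <;> rfl
  g_tp p := p.elim

/-- The disjoint union of two cobordisms. -/
def sum {M₀ M₁ N₀ N₁ : XMan X x₀} (W : XCob M₀ M₁) (V : XCob N₀ N₁) :
    XCob (M₀.sum N₀) (M₁.sum N₁) where
  carrier := W.carrier ⊕ V.carrier
  bot := ⟨Sum.map W.bot V.bot, W.bot.continuous.sumMap V.bot.continuous⟩
  tp := ⟨Sum.map W.tp V.tp, W.tp.continuous.sumMap V.tp.continuous⟩
  bd_injective := by
    have hW := W.bd_injective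
    have hV := V.bd_injective
    rintro ((p | p) | (p | p)) ((q | q) | (q | q)) h
    · rw [Sum.inl_injective (@hW (Sum.inl p) (Sum.inl q) (Sum.inl_injective h))]
    · exact absurd h Sum.inl_ne_inr
    · exact absurd (@hW (Sum.inl p) (Sum.inr q) (Sum.inl_injective h)) Sum.inl_ne_inr
    · exact absurd h Sum.inl_ne_inr
    · exact absurd h Sum.inr_ne_inl
    · rw [Sum.inl_injective (@hV (Sum.inl p) (Sum.inl q) (Sum.inr_injective h))]
    · exact absurd h Sum.inr_ne_inl
    · exact absurd (@hV (Sum.inl p) (Sum.inr q) (Sum.inr_injective h)) Sum.inl_ne_inr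
    · exact absurd (@hW (Sum.inr p) (Sum.inl q) (Sum.inl_injective h)) Sum.inr_ne_inl
    · exact absurd h Sum.inl_ne_inr
    · rw [Sum.inr_injective (@hW (Sum.inr p) (Sum.inr q) (Sum.inl_injective h))]
    · exact absurd h Sum.inl_ne_inr
    · exact absurd h Sum.inr_ne_inl
    · exact absurd (@hV (Sum.inr p) (Sum.inl q) (Sum.inr_injective h)) Sum.inr_ne_inl
    · exact absurd h Sum.inr_ne_inl
    · rw [Sum.inr_injective (@hV (Sum.inr p) (Sum.inr q) (Sum.inr_injective h))]
  isSurface := by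
    convert W.isSurface.sum V.isSurface using 1
    ext x
    constructor
    · rintro ⟨(p | p) | (p | p), rfl⟩
      · exact Or.inl ⟨_, ⟨Sum.inl p, rfl⟩, rfl⟩
      · exact Or.inr ⟨_, ⟨Sum.inl p, rfl⟩, rfl⟩
      · exact Or.inl ⟨_, ⟨Sum.inr p, rfl⟩, rfl⟩
      · exact Or.inr ⟨_, ⟨Sum.inr p, rfl⟩, rfl⟩
    · rintro (⟨_, ⟨p | p, rfl⟩, rfl⟩ | ⟨_, ⟨p | p, rfl⟩, rfl⟩)
      · exact ⟨Sum.inl (Sum.inl p), rfl⟩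
      · exact ⟨Sum.inr (Sum.inl p), rfl⟩
      · exact ⟨Sum.inl (Sum.inr p), rfl⟩
      · exact ⟨Sum.inr (Sum.inr p), rfl⟩
  g := ⟨Sum.elim W.g V.g, W.g.continuous.sumElim V.g.continuous⟩
  g_bot := by
    rintro (p | p)
    · exact W.g_bot p
    · exact V.g_bot p
  g_tp := by
    rintro (p | p)
    · exact W.g_tp p
    · exact V.g_tp p

/-- `W` is obtained from `W₀` and `W₁` by gluing the top base of `W₀` to the bottom base of `W₁`
along the `X`-homeomorphism `f`. -/
def IsGluing {M₀ N N' M₁ : XMan X x₀} (W₀ : XCob M₀ N) (f : XHomeo N N') (W₁ : XCob N' M₁)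
    (W : XCob M₀ M₁) : Prop :=
  ∃ (j₀ : C(W₀.carrier, W.carrier)) (j₁ : C(W₁.carrier, W.carrier)),
    Function.Injective j₀ ∧ Function.Injective j₁ ∧ Set.range j₀ ∪ Set.range j₁ = Set.univ ∧
    (∀ a b, j₀ a = j₁ b ↔ ∃ n, a = W₀.tp n ∧ b = W₁.bot (f.toHomeo n)) ∧
    (∀ p, j₀ (W₀.bot p) = W.bot p) ∧ (∀ p, j₁ (W₁.tp p) = W.tp p) ∧
    (∀ a, W.g (j₀ a) = W₀.g a) ∧ (∀ b, W.g (j₁ b) = W₁.g b)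

end XCob

/-! ### Unoriented `(1+1)`-dimensional HQFTs -/

open TensorProduct

/-- An unoriented `(1+1)`-dimensional homotopy quantum field theory over `R` with target `X`. The
identifications `A (M ⊔ N) = A M ⊗ A N` and `A ∅ = R` are isomorphisms, natural and coherent with
the associativity, commutativity and unit of the disjoint union. -/
structure HQFT (X : Type u) [TopologicalSpace X] (x₀ : X) (R : Type v) [CommRing R] where
  A : XMan X x₀ → Type w
  [addCommGroup : ∀ M, AddCommGroup (A M)]
  [module : ∀ M, Module R (A M)]
  [finite : ∀ M, Module.Finite R (A M)]
  [projective : ∀ M, Module.Projective R (A M)]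
  /-- the isomorphism induced by an `X`-homeomorphism -/
  map : ∀ {M N : XMan X x₀}, XHomeo M N → (A M ≃ₗ[R] A N)
  /-- the homomorphism of an `X`-cobordism -/
  τ : ∀ {M₀ M₁ : XMan X x₀}, XCob M₀ M₁ → (A M₀ →ₗ[R] A M₁)
  map_trans : ∀ {M N P : XMan X x₀} (e : XHomeo M N) (f : XHomeo N P) (a : A M),
    map (e.trans f) a = map f (map e a)
  sumEquiv : ∀ M N : XMan X x₀, (A M ⊗[R] A N) ≃ₗ[R] A (M.sum N)
  sumEquiv_natural : ∀ {M N M' N' : XMan X x₀} (e : XHomeo M M') (f : XHomeo N N') (a : A M)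
    (b : A N), map (e.sum f) (sumEquiv M N (a ⊗ₜ b)) = sumEquiv M' N' (map e a ⊗ₜ map f b)
  sumEquiv_assoc : ∀ (M N P : XMan X x₀) (a : A M) (b : A N) (c : A P),
    map (XHomeo.sumAssoc M N P) (sumEquiv (M.sum N) P (sumEquiv M N (a ⊗ₜ b) ⊗ₜ c)) =
      sumEquiv M (N.sum P) (a ⊗ₜ sumEquiv N P (b ⊗ₜ c))
  sumEquiv_comm : ∀ (M N : XMan X x₀) (a : A M) (b : A N),
    map (XHomeo.sumComm M N) (sumEquiv M N (a ⊗ₜ b)) = sumEquiv N M (b ⊗ₜ a)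
  emptyEquiv : A (XMan.empty : XMan X x₀) ≃ₗ[R] R
  sumEquiv_empty : ∀ (M : XMan X x₀) (a : A M) (r : A (XMan.empty : XMan X x₀)),
    map (XHomeo.sumEmpty M) (sumEquiv M XMan.empty (a ⊗ₜ r)) = emptyEquiv r • a
  τ_natural : ∀ {M₀ M₁ M₀' M₁' : XMan X x₀} (W : XCob M₀ M₁) (W' : XCob M₀' M₁')
    (f₀ : XHomeo M₀ M₀') (f₁ : XHomeo M₁ M₁') (f : W.carrier ≃ₜ W'.carrier),
    (∀ p, f (W.bot p) = W'.bot (f₀.toHomeo p)) → (∀ p, f (W.tp p) = W'.tp (f₁.toHomeo p)) →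
    (∀ q, W'.g (f q) = W.g q) → ∀ a, τ W' (map f₀ a) = map f₁ (τ W a)
  τ_sum : ∀ {M₀ M₁ N₀ N₁ : XMan X x₀} (W : XCob M₀ M₁) (V : XCob N₀ N₁) (a : A M₀) (b : A N₀),
    τ (W.sum V) (sumEquiv M₀ N₀ (a ⊗ₜ b)) = sumEquiv M₁ N₁ (τ W a ⊗ₜ τ V b)
  τ_glue : ∀ {M₀ N N' M₁ : XMan X x₀} (W₀ : XCob M₀ N) (f : XHomeo N N') (W₁ : XCob N' M₁)
    (W : XCob M₀ M₁), XCob.IsGluing W₀ f W₁ W → ∀ a, τ W a = τ W₁ (map f (τ W₀ a))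
  τ_cylinder : ∀ (M : XMan X x₀) (G : C(M.carrier × I, X)) (h0 : ∀ p, G (p, 0) = M.g p)
    (h1 : ∀ p, G (p, 1) = M.g p), (∀ b ∈ M.base, ∀ t, G (b, t) = x₀) →
    ∀ a, τ (XCob.cylinder M G h0 h1) a = a
  τ_homotopy : ∀ {M₀ M₁ : XMan X x₀} (W : XCob M₀ M₁) (g' : C(W.carrier, X))
    (hb : ∀ p, g' (W.bot p) = M₀.g p) (ht : ∀ p, g' (W.tp p) = M₁.g p),
    ContinuousMap.HomotopicRel W.g g' (Set.range (Sum.elim W.bot W.tp)) →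
    τ (W.withMap g' hb ht) = τ W

attribute [instance] HQFT.addCommGroup HQFT.module HQFT.finite HQFT.projective

/-- The Frobenius pairing `η` on `A M`, the value of the theory on the bent cylinder. -/
noncomputable def HQFT.pairing {X : Type u} [TopologicalSpace X] {x₀ : X} {R : Type v} [CommRing R]
    (Q : HQFT.{u, v, w} X x₀ R) (M : XMan X x₀) : Q.A M →ₗ[R] Q.A M →ₗ[R] R :=
  TensorProduct.curry
    (Q.emptyEquiv.toLinearMap ∘ₗ Q.τ (XCob.bentCylinder M) ∘ₗ (Q.sumEquiv M M).toLinearMap)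

/-! ### Singular homology and `K(π,1)` spaces -/

/-- `H₁(F; 𝔽₂)`, first singular homology. -/
noncomputable abbrev H1F2 (F : Type) [TopologicalSpace F] : ModuleCat.{0} (ZMod 2) :=
  ((AlgebraicTopology.singularHomologyFunctor (ModuleCat.{0} (ZMod 2)) 1).obj
    (ModuleCat.of (ZMod 2) (ZMod 2))).obj (TopCat.of F)

/-- The map induced by a continuous map on `H₁(-; 𝔽₂)`. -/
noncomputable def H1F2.map {F G : Type} [TopologicalSpace F] [TopologicalSpace G] (f : C(F, G)) :
    H1F2 F →ₗ[ZMod 2] H1F2 G :=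
  (((AlgebraicTopology.singularHomologyFunctor (ModuleCat.{0} (ZMod 2)) 1).obj
    (ModuleCat.of (ZMod 2) (ZMod 2))).map (TopCat.ofHom f)).hom

/-- `(X, x₀)` is an Eilenberg-Mac Lane space of type `K(G, 1)`, with a chosen identification of its
fundamental group with `G`. -/
structure EilenbergMacLaneOne (X : Type u) [TopologicalSpace X] (x₀ : X) (G : Type v) [Group G] where
  t2 : T2Space X
  cw : Nonempty (Topology.CWComplex (Set.univ : Set X))
  pathConnected : PathConnectedSpace X
  piOne : FundamentalGroup X x₀ ≃* G
  higher : ∀ n : ℕ, 2 ≤ n → Subsingleton (π_ n X x₀)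

/-- The element of `π₁(X, x₀)` represented by a loop based at `x₀`. -/
def loopClass {X : Type u} [TopologicalSpace X] {x₀ : X} (γ : C(UnitAddCircle, X))
    (h : γ 0 = x₀) : FundamentalGroup X x₀ :=
  FundamentalGroup.fromPath ⟦{ toFun := fun t => γ ((t : ℝ) : UnitAddCircle)
                               continuous_toFun := by
                                 exact γ.continuous.comp
                                   ((AddCircle.continuous_mk' (1 : ℝ)).comp continuous_subtype_val)
                               source' := by simpa using h
                               target' := by
                                 have h1 : ((1 : ℝ) : UnitAddCircle) = 0 := AddCircle.coe_period 1
                                 simpa [h1] using h }⟧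

/-! ### Link diagrams on surfaces -/

/-- An orientation of a surface: a sign for every open embedding of the plane, which is unchanged
under isotopies of open embeddings and reversed by precomposition with a reflection. -/
structure SurfaceOrientation (F : Type) [TopologicalSpace F] where
  sign : {f : ℝ × ℝ → F // IsOpenEmbedding f} → ℤˣ
  isotopy : ∀ (H : I → ℝ × ℝ → F) (hH : ∀ t, IsOpenEmbedding (H t)),
    Continuous (fun x : I × (ℝ × ℝ) => H x.1 x.2) → sign ⟨H 0, hH 0⟩ = sign ⟨H 1, hH 1⟩
  reflect : ∀ (f : ℝ × ℝ → F) (hf : IsOpenEmbedding f)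
    (hf' : IsOpenEmbedding (fun z : ℝ × ℝ => f (z.2, z.1))),
    sign ⟨fun z : ℝ × ℝ => f (z.2, z.1), hf'⟩ = - sign ⟨f, hf⟩

/-- The two strands at a crossing in the model plane, the diagonal `y = x` (`true`), directed by
`(1, 1)`, and the diagonal `y = -x` (`false`), directed by `(-1, 1)`. -/
def modelStrand (b : Bool) (t : ℝ) : ℝ × ℝ := if b then (t, t) else (-t, t)

/-- An oriented link projection on the oriented surface `F` with boundary `bd`: a generic immersion
of `k` oriented circles in the interior of `F`, whose `n` (ordered) double points are transverse.
Around each double point an orientation preserving chart is chosen, in which the curve is the union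
of the two diagonals; these charts are disjoint. -/
structure LinkProjection (F : Type) [TopologicalSpace F] (bd : Set F)
    (o : SurfaceOrientation F) where
  /-- number of circles -/
  k : ℕ
  /-- number of crossings -/
  n : ℕ
  curve : C(Fin k × UnitAddCircle, F)
  curve_interior : ∀ s, curve s ∉ bd
  box : Fin n → ℝ × ℝ → F
  box_openEmbedding : ∀ i, IsOpenEmbedding (box i)
  box_oriented : ∀ i, o.sign ⟨box i, box_openEmbedding i⟩ = 1
  box_disjoint : ∀ i j, i ≠ j → Disjoint (Set.range (box i)) (Set.range (box j))
  /-- the circle of the strand -/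
  circ : Fin n → Bool → Fin k
  /-- the position on its circle of the points of the strand, in the order of the orientation -/
  pos : Fin n → Bool → ℝ → ℝ
  pos_continuous : ∀ i b, Continuous (pos i b)
  pos_strictMono : ∀ i b, StrictMono (pos i b)
  /-- whether the orientation of the strand agrees (`1`) with that of the model or not (`-1`) -/
  dir : Fin n → Bool → ℤˣ
  curve_strand : ∀ i b t,
    curve (circ i b, (pos i b t : UnitAddCircle)) = box i (modelStrand b (((dir i b : ℤ) : ℝ) * t))
  curve_box : ∀ i s, curve s ∈ Set.range (box i) →
    ∃ b t, s = (circ i b, (pos i b t : UnitAddCircle))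
  curve_injective : ∀ s s', curve s = curve s' → s ≠ s' → ∃ i, curve s = box i (0, 0)
  curve_flat : ∀ s, (∀ i, curve s ≠ box i (0, 0)) → ∃ e : OpenPartialHomeomorph F (ℝ × ℝ),
    curve s ∈ e.source ∧ ∀ q ∈ e.source, (q ∈ Set.range curve ↔ (e q).2 = 0)

namespace LinkProjection

variable {F : Type} [TopologicalSpace F] {bd : Set F} {o : SurfaceOrientation F}
  (P : LinkProjection F bd o)

/-- The underlying four-valent graph, as a subset of the surface. -/
def image : Set F := Set.range P.curve

/-- The curve system obtained by replacing the `i`-th crossing with the model smoothing `ρ i`. -/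
def smoothing (ρ : Fin P.n → Bool) : Set F :=
  {q | (q ∈ P.image ∧ ∀ i, q ∉ Set.range (P.box i)) ∨ ∃ i z, P.box i z = q ∧ z ∈ smoothingModel (ρ i)}

/-- The trace in `F × [0,1]` of the saddle move at the `j`-th crossing: the cylinder over the
smoothing `ρ`, with the saddle inserted at the `j`-th crossing. -/
def trace (ρ : Fin P.n → Bool) (j : Fin P.n) : Set (F × I) :=
  {x | (x.1 ∈ P.smoothing ρ ∧ x.1 ∉ Set.range (P.box j)) ∨
    ∃ z, P.box j z = x.1 ∧ (z, x.2) ∈ saddleModel (ρ j)}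

theorem box_mem_image (i : Fin P.n) (z : ℝ × ℝ) : P.box i z ∈ P.image ↔ |z.1| = |z.2| := by
  constructor
  · rintro ⟨s, hs⟩
    obtain ⟨b, t, rfl⟩ := P.curve_box i s ⟨z, hs.symm⟩
    rw [P.curve_strand] at hs
    have h := (P.box_openEmbedding i).injective hs
    rw [← h]
    cases b <;> simp [modelStrand]
  · intro h
    have hd : ∀ b, (((P.dir i b : ℤ) : ℝ) * (((P.dir i b : ℤ) : ℝ) * z.2)) = z.2 := by
      intro b
      rw [← mul_assoc, ← Int.cast_mul, ← Units.val_mul, Int.units_mul_self]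
      simp
    rcases abs_eq_abs.1 h with h | h
    · refine ⟨_, (P.curve_strand i true (((P.dir i true : ℤ) : ℝ) * z.2)).trans ?_⟩
      rw [hd]
      congr 1
      exact Prod.ext h.symm rfl
    · refine ⟨_, (P.curve_strand i false (((P.dir i false : ℤ) : ℝ) * z.2)).trans ?_⟩
      rw [hd]
      congr 1
      exact Prod.ext h.symm rfl

theorem box_mem_smoothing (ρ : Fin P.n → Bool) (i : Fin P.n) (z : ℝ × ℝ) :
    P.box i z ∈ P.smoothing ρ ↔ z ∈ smoothingModel (ρ i) := by
  constructor
  · rintro (⟨-, h⟩ | ⟨j, w, h, hw⟩)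
    · exact absurd ⟨z, rfl⟩ (h i)
    · by_cases hij : j = i
      · subst hij
        rwa [← (P.box_openEmbedding j).injective h]
      · exact absurd h (Set.disjoint_iff_forall_ne.1 (P.box_disjoint j i hij) ⟨w, rfl⟩ ⟨z, rfl⟩)
  · intro h
    exact Or.inr ⟨i, z, rfl, h⟩

theorem mem_trace_box (ρ : Fin P.n → Bool) (j : Fin P.n) (z : ℝ × ℝ) (t : I) :
    (P.box j z, t) ∈ P.trace ρ j ↔ (z, t) ∈ saddleModel (ρ j) := by
  constructor
  · rintro (⟨-, h⟩ | ⟨w, h, hw⟩)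
    · exact absurd ⟨z, rfl⟩ h
    · rwa [← (P.box_openEmbedding j).injective h]
  · intro h
    exact Or.inr ⟨z, rfl, h⟩

/-- Outside the squares `[-1,1]²` of the boxes the smoothing agrees with the projection. -/
theorem mem_smoothing_off (ρ : Fin P.n → Bool) {q : F} (hq : ∀ i, q ∉ P.box i '' square) :
    q ∈ P.smoothing ρ ↔ q ∈ P.image := by
  by_cases h : ∃ i, q ∈ Set.range (P.box i)
  · obtain ⟨i, z, rfl⟩ := h
    rw [P.box_mem_smoothing, P.box_mem_image, smoothingModel_off]
    exact fun hz => hq i ⟨z, hz, rfl⟩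
  · have h' : ∀ i, q ∉ Set.range (P.box i) := fun i hi => h ⟨i, hi⟩
    constructor
    · rintro (h1 | ⟨i, z, h1, -⟩)
      · exact h1.1
      · exact absurd ⟨z, h1⟩ (h' i)
    · intro h1
      exact Or.inl ⟨h1, h'⟩

/-- Outside the square `[-1,1]²` of the `j`-th box the trace is a cylinder. -/
theorem mem_trace_off (ρ : Fin P.n → Bool) (j : Fin P.n) {q : F} (t : I)
    (hq : q ∉ P.box j '' square) : (q, t) ∈ P.trace ρ j ↔ q ∈ P.smoothing ρ := by
  by_cases h : q ∈ Set.range (P.box j)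
  · obtain ⟨z, rfl⟩ := h
    have hz : z ∉ square := fun hz => hq ⟨z, hz, rfl⟩
    rw [P.box_mem_smoothing, P.mem_trace_box, smoothingModel_off _ hz, saddleModel_off _ _ hz]
  · constructor
    · rintro (h1 | ⟨z, h1, -⟩)
      · exact h1.1
      · exact absurd ⟨z, h1⟩ h
    · intro h1
      exact Or.inl ⟨h1, h⟩

theorem mem_trace_zero (ρ : Fin P.n → Bool) (j : Fin P.n) (q : F) :
    (q, (0 : I)) ∈ P.trace ρ j ↔ q ∈ P.smoothing ρ := by
  by_cases h : q ∈ Set.range (P.box j)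
  · obtain ⟨z, rfl⟩ := h
    rw [P.mem_trace_box, P.box_mem_smoothing, saddleModel_zero]
  · exact P.mem_trace_off ρ j 0 (fun h1 => h (Set.image_subset_range _ _ h1))

theorem mem_trace_one (ρ ρ' : Fin P.n → Bool) (j : Fin P.n) (hj : ρ' j = !ρ j)
    (hne : ∀ i, i ≠ j → ρ' i = ρ i) (q : F) :
    (q, (1 : I)) ∈ P.trace ρ j ↔ q ∈ P.smoothing ρ' := by
  by_cases h : q ∈ Set.range (P.box j)
  · obtain ⟨z, rfl⟩ := h
    rw [P.mem_trace_box, P.box_mem_smoothing, saddleModel_one, hj]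
  · rw [P.mem_trace_off ρ j 1 (fun h1 => h (Set.image_subset_range _ _ h1))]
    by_cases h2 : ∃ i, q ∈ Set.range (P.box i)
    · obtain ⟨i, z, rfl⟩ := h2
      have hij : i ≠ j := by
        rintro rfl
        exact h ⟨z, rfl⟩
      rw [P.box_mem_smoothing, P.box_mem_smoothing, hne i hij]
    · have h' : ∀ i, q ∉ P.box i '' square :=
        fun i hi => h2 ⟨i, Set.image_subset_range _ _ hi⟩
      rw [P.mem_smoothing_off ρ h', P.mem_smoothing_off ρ' h']

section

variable [T2Space F]

theorem isCompact_square : IsCompact square := by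
  have h : square = Set.Icc (-1) 1 ×ˢ Set.Icc (-1) 1 := by
    ext z
    rw [Set.mem_prod, Set.mem_Icc, Set.mem_Icc, ← abs_le, ← abs_le]
    rfl
  rw [h]
  exact isCompact_Icc.prod isCompact_Icc

theorem isClosed_box_square (i : Fin P.n) : IsClosed (P.box i '' square) :=
  (isCompact_square.image (P.box_openEmbedding i).continuous).isClosed

theorem isOpen_off : IsOpen {q : F | ∀ i, q ∉ P.box i '' square} := by
  have h : {q : F | ∀ i, q ∉ P.box i '' square} = ⋂ i, (P.box i '' square)ᶜ := by
    ext q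
    simp
  rw [h]
  exact isOpen_iInter_of_finite fun i => (P.isClosed_box_square i).isOpen_compl

theorem isClosed_image : IsClosed P.image := (isCompact_range P.curve.continuous).isClosed

theorem isClosed_smoothing (ρ : Fin P.n → Bool) : IsClosed (P.smoothing ρ) := by
  rw [← isOpen_compl_iff, isOpen_iff_mem_nhds]
  intro q hq
  by_cases h : ∃ i, q ∈ Set.range (P.box i)
  · obtain ⟨i, z, rfl⟩ := h
    have hz : z ∉ smoothingModel (ρ i) := fun hz => hq ((P.box_mem_smoothing ρ i z).2 hz)
    refine Filter.mem_of_superset (((P.box_openEmbedding i).isOpenMap _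
      (isClosed_smoothingModel (ρ i)).isOpen_compl).mem_nhds ⟨z, hz, rfl⟩) ?_
    rintro _ ⟨w, hw, rfl⟩ h
    exact hw ((P.box_mem_smoothing ρ i w).1 h)
  · have h' : ∀ i, q ∉ P.box i '' square := fun i hi => h ⟨i, Set.image_subset_range _ _ hi⟩
    refine Filter.mem_of_superset ((P.isOpen_off.inter P.isClosed_image.isOpen_compl).mem_nhds
      ⟨h', fun h1 => hq ((P.mem_smoothing_off ρ h').2 h1)⟩) ?_
    rintro w ⟨hw, hw'⟩ h1
    exact hw' ((P.mem_smoothing_off ρ hw).1 h1)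

theorem isClosed_trace (ρ : Fin P.n → Bool) (j : Fin P.n) : IsClosed (P.trace ρ j) := by
  rw [← isOpen_compl_iff, isOpen_iff_mem_nhds]
  rintro ⟨q, t⟩ hq
  by_cases h : q ∈ Set.range (P.box j)
  · obtain ⟨z, rfl⟩ := h
    have hz : (z, t) ∉ saddleModel (ρ j) := fun hz => hq ((P.mem_trace_box ρ j z t).2 hz)
    refine Filter.mem_of_superset ((((P.box_openEmbedding j).prodMap
      (IsOpenEmbedding.id (X := I))).isOpenMap _
      (isClosed_saddleModel (ρ j)).isOpen_compl).mem_nhds ⟨(z, t), hz, rfl⟩) ?_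
    rintro _ ⟨⟨w, s⟩, hw, rfl⟩ h
    exact hw ((P.mem_trace_box ρ j w s).1 h)
  · have h' : q ∉ P.box j '' square := fun hi => h (Set.image_subset_range _ _ hi)
    refine Filter.mem_of_superset ((((P.isClosed_box_square j).isOpen_compl.inter
      (P.isClosed_smoothing ρ).isOpen_compl).preimage continuous_fst).mem_nhds
      ⟨h', fun h1 => hq ((P.mem_trace_off ρ j t h').2 h1)⟩) ?_
    rintro ⟨w, s⟩ ⟨hw, hw'⟩ h1
    exact hw' ((P.mem_trace_off ρ j s hw).1 h1)

theorem isCurve_smoothing (ρ : Fin P.n → Bool) : IsCurve (P.smoothing ρ) := by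
  rintro ⟨q, hq⟩
  by_cases h : ∃ i, q ∈ Set.range (P.box i)
  · obtain ⟨i, z, rfl⟩ := h
    have hz : z ∈ smoothingModel (ρ i) := (P.box_mem_smoothing ρ i z).1 hq
    let f : smoothingModel (ρ i) → P.smoothing ρ :=
      fun w => ⟨P.box i w.1, (P.box_mem_smoothing ρ i w.1).2 w.2⟩
    have hf : IsOpenEmbedding f := by
      refine ⟨⟨?_, ?_⟩, ?_⟩
      · exact IsInducing.subtypeVal.of_comp_iff.1
          ((P.box_openEmbedding i).isInducing.comp IsInducing.subtypeVal)
      · intro a b hab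
        exact Subtype.ext ((P.box_openEmbedding i).injective (congrArg Subtype.val hab))
      · have h1 := (P.box_openEmbedding i).isOpen_range.preimage
          (continuous_subtype_val (p := fun q => q ∈ P.smoothing ρ))
        convert h1 using 1
        ext ⟨q, hq⟩
        constructor
        · rintro ⟨w, hw⟩
          exact ⟨w.1, congrArg Subtype.val hw⟩
        · rintro ⟨w, hw⟩
          have hw : P.box i w = q := hw
          subst hw
          exact ⟨⟨w, (P.box_mem_smoothing ρ i w).1 hq⟩, rfl⟩
    obtain ⟨e, he⟩ := isCurve_smoothingModel (ρ i) ⟨z, hz⟩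
    refine ⟨e.lift_openEmbedding hf, ?_⟩
    rw [OpenPartialHomeomorph.lift_openEmbedding_source]
    exact ⟨_, he, rfl⟩
  · have h' : ∀ i, q ∉ P.box i '' square := fun i hi => h ⟨i, Set.image_subset_range _ _ hi⟩
    obtain ⟨s, hs⟩ := (P.mem_smoothing_off ρ h').1 hq
    obtain ⟨e, he, heD⟩ := P.curve_flat s (fun i hi => h ⟨i, (0, 0), by rw [← hi, hs]⟩)
    rw [hs] at he
    have heD' : ∀ q ∈ e.source, (∀ i, q ∉ P.box i '' square) →
        (q ∈ P.smoothing ρ ↔ (e q).2 = 0) := by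
      intro q hq hq'
      rw [P.mem_smoothing_off ρ hq']
      exact heD q hq
    classical
    let U : Set F := {q | ∀ i, q ∉ P.box i '' square}
    have hU : IsOpen U := P.isOpen_off
    have hinv : ∀ x : ℝ, (x, (0 : ℝ)) ∈ e.target ∩ e.symm ⁻¹' U → e.symm (x, 0) ∈ P.smoothing ρ := by
      rintro x ⟨hx, hxU⟩
      rw [heD' _ (e.map_target hx) hxU, e.right_inv hx]
    refine ⟨{ toFun := fun w => (e w.1).1
              invFun := fun x => if hx : (x, (0 : ℝ)) ∈ e.target ∩ e.symm ⁻¹' U then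
                ⟨e.symm (x, 0), hinv x hx⟩ else ⟨q, hq⟩
              source := {w | w.1 ∈ e.source ∩ U}
              target := {x | (x, (0 : ℝ)) ∈ e.target ∩ e.symm ⁻¹' U}
              map_source' := ?_
              map_target' := ?_
              left_inv' := ?_
              right_inv' := ?_
              continuousOn_toFun := ?_
              continuousOn_invFun := ?_
              open_source := ?_
              open_target := ?_ }, ⟨he, h'⟩⟩
    · rintro ⟨w, hw⟩ ⟨h1, h2⟩
      have h3 : ((e w).1, (0 : ℝ)) = e w := Prod.ext rfl ((heD' w h1 h2).1 hw).symm
      change ((e w).1, (0 : ℝ)) ∈ e.target ∩ e.symm ⁻¹' U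
      rw [h3]
      refine ⟨e.map_source h1, ?_⟩
      change e.symm (e w) ∈ U
      rw [e.left_inv h1]
      exact h2
    · intro x hx
      have hx' : (x, (0 : ℝ)) ∈ e.target ∩ e.symm ⁻¹' U := hx
      rw [dif_pos hx']
      exact ⟨e.map_target hx'.1, hx'.2⟩
    · rintro ⟨w, hw⟩ ⟨h1, h2⟩
      have h3 : ((e w).1, (0 : ℝ)) = e w := Prod.ext rfl ((heD' w h1 h2).1 hw).symm
      have h4 : ((e w).1, (0 : ℝ)) ∈ e.target ∩ e.symm ⁻¹' U := by
        rw [h3]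
        refine ⟨e.map_source h1, ?_⟩
        change e.symm (e w) ∈ U
        rw [e.left_inv h1]
        exact h2
      rw [dif_pos h4]
      apply Subtype.ext
      change e.symm ((e w).1, 0) = w
      rw [h3, e.left_inv h1]
    · intro x hx
      have hx' : (x, (0 : ℝ)) ∈ e.target ∩ e.symm ⁻¹' U := hx
      rw [dif_pos hx']
      change (e (e.symm (x, 0))).1 = x
      rw [e.right_inv hx'.1]
    · exact continuous_fst.comp_continuousOn
        (e.continuousOn.comp continuous_subtype_val.continuousOn (fun w hw => hw.1))
    · refine IsInducing.subtypeVal.continuousOn_iff.2 ?_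
      have h1 : ContinuousOn (fun x : ℝ => e.symm (x, 0))
          {x | (x, (0 : ℝ)) ∈ e.target ∩ e.symm ⁻¹' U} :=
        e.continuousOn_symm.comp (by fun_prop) (fun x hx => hx.1)
      refine h1.congr ?_
      intro x hx
      have hx' : (x, (0 : ℝ)) ∈ e.target ∩ e.symm ⁻¹' U := hx
      simp only [Function.comp]
      rw [dif_pos hx']
    · exact (e.open_source.inter hU).preimage continuous_subtype_val
    · exact (e.isOpen_inter_preimage_symm hU).preimage (by fun_prop)

theorem isSurface_trace (ρ : Fin P.n → Bool) (j : Fin P.n) :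
    IsSurface (P.trace ρ j) {x | x.1.2 = 0 ∨ x.1.2 = 1} := by
  rintro ⟨⟨q, t⟩, hq⟩
  by_cases h : q ∈ Set.range (P.box j)
  · obtain ⟨z, rfl⟩ := h
    let f : saddleModel (ρ j) → P.trace ρ j :=
      fun w => ⟨(P.box j w.1.1, w.1.2), (P.mem_trace_box ρ j w.1.1 w.1.2).2 w.2⟩
    have hb : IsOpenEmbedding (Prod.map (P.box j) (id : I → I)) :=
      (P.box_openEmbedding j).prodMap IsOpenEmbedding.id
    have hf : IsOpenEmbedding f := by
      refine ⟨⟨?_, ?_⟩, ?_⟩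
      · exact IsInducing.subtypeVal.of_comp_iff.1 (hb.isInducing.comp IsInducing.subtypeVal)
      · intro a b hab
        exact Subtype.ext (hb.injective (congrArg Subtype.val hab))
      · have h1 := hb.isOpen_range.preimage
          (continuous_subtype_val (p := fun q => q ∈ P.trace ρ j))
        convert h1 using 1
        ext ⟨q, hq⟩
        constructor
        · rintro ⟨w, hw⟩
          exact ⟨w.1, congrArg Subtype.val hw⟩
        · rintro ⟨w, hw⟩
          have hw : (P.box j w.1, w.2) = q := hw
          subst hw
          exact ⟨⟨w, (P.mem_trace_box ρ j w.1 w.2).1 hq⟩, rfl⟩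
    exact (isSurface_saddleModel (ρ j) ⟨(z, t), (P.mem_trace_box ρ j z t).1 hq⟩).of_openEmbedding
      hf (C := {x | x.1.2 = 0 ∨ x.1.2 = 1}) (fun v => Iff.rfl)
  · have h' : q ∉ P.box j '' square := fun hi => h (Set.image_subset_range _ _ hi)
    have hU : IsOpen (P.box j '' square)ᶜ := (P.isClosed_box_square j).isOpen_compl
    -- the part of the smoothing away from the crossing
    let V : Set (P.smoothing ρ) := {w | w.1 ∉ P.box j '' square}
    have hV : IsOpen V := hU.preimage continuous_subtype_val
    have hVc : IsCurve V := by
      rintro ⟨w, hw⟩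
      obtain ⟨e, he⟩ := P.isCurve_smoothing ρ w
      have : Nonempty V := ⟨⟨w, hw⟩⟩
      exact ⟨(hV.isOpenEmbedding_subtypeVal.toOpenPartialHomeomorph Subtype.val).trans e,
        by simpa using he⟩
    let f : V × I → P.trace ρ j :=
      fun w => ⟨(w.1.1.1, w.2), (P.mem_trace_off ρ j w.2 w.1.2).2 w.1.1.2⟩
    have hf : IsOpenEmbedding f := by
      refine ⟨⟨?_, ?_⟩, ?_⟩
      · refine IsInducing.subtypeVal.of_comp_iff.1 ?_
        exact (IsInducing.subtypeVal.comp IsInducing.subtypeVal).prodMap IsInducing.id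
      · rintro ⟨a, s⟩ ⟨b, r⟩ hab
        have h1 : ((a.1.1, s) : F × I) = (b.1.1, r) := congrArg Subtype.val hab
        exact Prod.ext (Subtype.ext (Subtype.ext (Prod.mk.inj h1).1)) (Prod.mk.inj h1).2
      · have h1 := (hU.preimage continuous_fst).preimage
          (continuous_subtype_val (p := fun q : F × I => q ∈ P.trace ρ j))
        convert h1 using 1
        ext ⟨⟨q, t⟩, hq⟩
        constructor
        · rintro ⟨w, hw⟩
          have hw' : w.1.1.1 = q := congrArg (fun x => x.1.1) hw
          change q ∉ P.box j '' square
          rw [← hw']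
          exact w.1.2
        · intro hw
          exact ⟨(⟨⟨q, (P.mem_trace_off ρ j t hw).1 hq⟩, hw⟩, t), rfl⟩
    exact (hVc.prod_I (⟨⟨q, (P.mem_trace_off ρ j t h').1 hq⟩, h'⟩, t)).of_openEmbedding hf
      (C := {x | x.1.2 = 0 ∨ x.1.2 = 1}) (fun v => Iff.rfl)

end

end LinkProjection

/-- An oriented link diagram: an oriented link projection and, at each crossing, the choice of the
upper strand, the diagonal `y = x` (`true`) or the diagonal `y = -x` (`false`) of the box. -/
structure LinkDiagram (F : Type) [TopologicalSpace F] (bd : Set F) (o : SurfaceOrientation F)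
    extends LinkProjection F bd o where
  upper : Fin n → Bool

namespace LinkDiagram

variable {F : Type} [TopologicalSpace F] {bd : Set F} {o : SurfaceOrientation F}

/-- The diagram `D^!` obtained by changing all crossings. -/
def mirror (D : LinkDiagram F bd o) : LinkDiagram F bd o :=
  { D with upper := fun i => !D.upper i }

variable (D : LinkDiagram F bd o)

/-- The sign of a crossing: `1` if the directions of the upper and the lower strand, in this order,
form a positive basis of the oriented plane. -/
def crossingSign (i : Fin D.n) : ℤˣ :=
  if D.upper i then D.dir i true * D.dir i false else -(D.dir i true * D.dir i false)

/-- The number `n₋` of negative crossings. -/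
def nNeg : ℕ := (Finset.univ.filter fun i => D.crossingSign i = -1).card

/-- The model smoothings of the smoothing `D_ε`. The `0`-smoothing at a crossing joins the two
regions swept by the upper strand when it turns counterclockwise to the lower strand, the
`1`-smoothing joins the other two regions; the model smoothing `true` joins the regions above and
below the crossing, and `false` those on its left and right. -/
def resolution (ε : Fin D.n → Bool) : Fin D.n → Bool := fun i => xor (D.upper i) (ε i)

/-- The homological degree `|ε| - n₋` of the smoothing `D_ε`. -/
def degree (ε : Fin D.n → Bool) : ℤ :=
  ((Finset.univ.filter fun i => ε i = true).card : ℤ) - D.nNeg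

theorem mirror_nNeg : (D.mirror.nNeg : ℤ) = D.n - D.nNeg := by
  have h1 : ∀ i, D.mirror.crossingSign i = -D.crossingSign i := by
    intro i
    change (if (!D.upper i) = true then _ else _) = -(if D.upper i = true then _ else _)
    cases D.upper i <;> simp [mirror]
  have h2 : (Finset.univ.filter fun i : Fin D.mirror.n => D.mirror.crossingSign i = -1) =
      (Finset.univ.filter fun i => ¬ D.crossingSign i = -1) := by
    ext i
    simp only [Finset.mem_filter, Finset.mem_univ, true_and]
    rw [h1 i]
    have h0 : ∀ u : ℤˣ, -u = -1 ↔ ¬ u = -1 := by decide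
    exact (h0 _).trans (Finset.mem_filter_univ (p := fun k => ¬ D.crossingSign k = -1) i).symm
  have h3 := Finset.card_filter_add_card_filter_not (s := (Finset.univ : Finset (Fin D.n)))
    (fun i => D.crossingSign i = -1)
  have h4 : D.mirror.nNeg = (Finset.univ.filter fun i => ¬ D.crossingSign i = -1).card :=
    congrArg Finset.card h2
  rw [Finset.card_univ, Fintype.card_fin] at h3
  have h5 : D.nNeg = (Finset.univ.filter fun i => D.crossingSign i = -1).card := rfl
  omega

/-- The smoothing of `D^!` with all choices exchanged has opposite degree. -/
theorem mirror_degree (ε : Fin D.n → Bool) :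
    D.mirror.degree (fun i => !ε i) = -D.degree ε := by
  have h := D.mirror_nNeg
  have h2 : (Finset.univ.filter fun i : Fin D.n => (!ε i) = true) =
      (Finset.univ.filter fun i => ¬ ε i = true) := by
    ext i
    simp
  have h3 := Finset.card_filter_add_card_filter_not (s := (Finset.univ : Finset (Fin D.n)))
    (fun i => ε i = true)
  rw [Finset.card_univ, Fintype.card_fin, ← h2] at h3
  have h4 : D.mirror.degree (fun i => !ε i) =
    ((Finset.univ.filter fun i : Fin D.n => (!ε i) = true).card : ℤ) - D.mirror.nNeg := rfl
  rw [h4, degree]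
  omega

/-- The smoothing of `D^!` with all choices exchanged is the same curve system as `D_ε`. -/
theorem mirror_resolution (ε : Fin D.n → Bool) :
    D.mirror.resolution (fun i => !ε i) = D.resolution ε := by
  funext i
  change xor (!D.upper i) (!ε i) = xor (D.upper i) (ε i)
  simp

end LinkDiagram

/-- The auxiliary choices that turn the smoothings of a projection and the traces of the saddle
moves into `X`-manifolds and `X`-cobordisms, where `X` is a `K(H₁(F; 𝔽₂), 1)`: base points on the
circles of the smoothings, and a map `c` from `F` to `X` that sends the base points to `x₀` and
every loop `γ` in `F` with `c (γ 0) = x₀` to the loop in `X` corresponding to the homology class of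
`γ`. (The class of `γ` is the image of the only nonzero element `u` of `H₁(S¹; 𝔽₂)`.) -/
structure Coloring {F : Type} [TopologicalSpace F] {bd : Set F} {o : SurfaceOrientation F}
    (P : LinkProjection F bd o) {X : Type u} [TopologicalSpace X] {x₀ : X}
    (K : EilenbergMacLaneOne X x₀ (Multiplicative (H1F2 F))) where
  c : C(F, X)
  c_loop : ∀ (γ : C(UnitAddCircle, F)) (h : c (γ 0) = x₀) (u : H1F2 UnitAddCircle), u ≠ 0 →
    K.piOne (loopClass (c.comp γ) h) = Multiplicative.ofAdd (H1F2.map γ u)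
  base : ∀ ρ : Fin P.n → Bool, Set (P.smoothing ρ)
  base_unique : ∀ ρ (p : P.smoothing ρ), ∃! b, b ∈ base ρ ∧ b ∈ connectedComponent p
  c_base : ∀ ρ, ∀ b ∈ base ρ, c b.1 = x₀

namespace Coloring

variable {F : Type} [TopologicalSpace F] [CompactSpace F] [T2Space F] {bd : Set F}
  {o : SurfaceOrientation F} {P : LinkProjection F bd o} {X : Type u} [TopologicalSpace X] {x₀ : X}
  {K : EilenbergMacLaneOne X x₀ (Multiplicative (H1F2 F))} (κ : Coloring P K)

/-- The smoothing `ρ` as an `X`-manifold. -/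
def man (ρ : Fin P.n → Bool) : XMan X x₀ where
  carrier := P.smoothing ρ
  compact := isCompact_iff_compactSpace.1 (P.isClosed_smoothing ρ).isCompact
  isCurve := P.isCurve_smoothing ρ
  base := κ.base ρ
  base_unique := κ.base_unique ρ
  g := ⟨fun q => κ.c q.1, κ.c.continuous.comp continuous_subtype_val⟩
  g_base := κ.c_base ρ

/-- The trace of the saddle move at the `j`-th crossing as an `X`-cobordism. -/
def cob (ρ ρ' : Fin P.n → Bool) (j : Fin P.n) (hj : ρ' j = !ρ j)
    (hne : ∀ i, i ≠ j → ρ' i = ρ i) : XCob (κ.man ρ) (κ.man ρ') where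
  carrier := P.trace ρ j
  compact := isCompact_iff_compactSpace.1 (P.isClosed_trace ρ j).isCompact
  bot := ⟨fun q => ⟨(q.1, 0), (P.mem_trace_zero ρ j q.1).2 q.2⟩,
    Continuous.subtype_mk (continuous_subtype_val.prodMk continuous_const) _⟩
  tp := ⟨fun q => ⟨(q.1, 1), (P.mem_trace_one ρ ρ' j hj hne q.1).2 q.2⟩,
    Continuous.subtype_mk (continuous_subtype_val.prodMk continuous_const) _⟩
  bd_injective := by
    rintro (p | p) (q | q) h
    · exact congrArg Sum.inl (Subtype.ext (congrArg (fun x => x.1.1) h))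
    · exact absurd (congrArg (fun x => x.1.2) h) zero_ne_one
    · exact absurd (congrArg (fun x => x.1.2) h) one_ne_zero
    · exact congrArg Sum.inr (Subtype.ext (congrArg (fun x => x.1.1) h))
  isSurface := by
    convert P.isSurface_trace ρ j using 1
    ext ⟨⟨q, t⟩, hq⟩
    constructor
    · rintro ⟨p | p, h⟩
      · exact Or.inl (congrArg (fun x => x.1.2) h).symm
      · exact Or.inr (congrArg (fun x => x.1.2) h).symm
    · rintro (h | h)
      · have h : t = 0 := h
        subst h
        exact ⟨Sum.inl ⟨q, (P.mem_trace_zero ρ j q).1 hq⟩, rfl⟩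
      · have h : t = 1 := h
        subst h
        exact ⟨Sum.inr ⟨q, (P.mem_trace_one ρ ρ' j hj hne q).1 hq⟩, rfl⟩
  g := ⟨fun x => κ.c x.1.1,
    κ.c.continuous.comp (continuous_fst.comp continuous_subtype_val)⟩
  g_bot _ := rfl
  g_tp _ := rfl

end Coloring

/-! ### The complex of a diagram and its dual -/

/-- The data of a cochain complex of `R`-modules: modules `C i` and maps `d i j : C i → C j`, of
which those with `j = i + 1` are the differentials. -/
structure ModuleComplex (R : Type v) [CommRing R] where
  C : ℤ → Type w
  [addCommGroup : ∀ i, AddCommGroup (C i)]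
  [module : ∀ i, Module R (C i)]
  d : ∀ i j, C i →ₗ[R] C j

attribute [instance] ModuleComplex.addCommGroup ModuleComplex.module

namespace ModuleComplex

variable {R : Type v} [CommRing R]

/-- The dual complex: `(C^*)^i = Hom(C^{-i}, R)` with the transposed differentials. -/
def dual (C : ModuleComplex.{v, w} R) : ModuleComplex.{v, max v w} R where
  C i := Module.Dual R (C.C (-i))
  d i j := (C.d (-j) (-i)).dualMap

/-- The value of an element of the dual complex, which is a linear form, on an element. -/
def dualValue (C : ModuleComplex.{v, w} R) {i : ℤ} (φ : C.dual.C i) (y : C.C (-i)) : R :=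
  (show Module.Dual R (C.C (-i)) from φ) y

/-- An isomorphism of complexes. -/
structure Iso (C : ModuleComplex.{v, w} R) (E : ModuleComplex.{v, max v w} R) where
  equiv : ∀ i, C.C i ≃ₗ[R] E.C i
  comm : ∀ i j, i + 1 = j → ∀ x, equiv j (C.d i j x) = E.d i j (equiv i x)

end ModuleComplex

namespace LinkDiagram

variable {F : Type} [TopologicalSpace F] [CompactSpace F] [T2Space F] {bd : Set F}
  {o : SurfaceOrientation F} (D : LinkDiagram F bd o) {X : Type u} [TopologicalSpace X] {x₀ : X}
  {K : EilenbergMacLaneOne X x₀ (Multiplicative (H1F2 F))} (κ : Coloring D.toLinkProjection K)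
  {R : Type v} [CommRing R] (Q : HQFT.{u, v, w} X x₀ R)

/-- `ε'` is obtained from `ε` by changing the `j`-th entry from `0` to `1`. -/
def IsStep (ε ε' : Fin D.n → Bool) (j : Fin D.n) : Prop :=
  ε j = false ∧ ε' j = true ∧ ∀ i, i ≠ j → ε' i = ε i

/-- The `X`-manifold `D_ε`. -/
def smoothingMan (ε : Fin D.n → Bool) : XMan X x₀ := κ.man (D.resolution ε)

/-- The `X`-cobordism `Σ_{ε → ε'}`. -/
def edgeCob {ε ε' : Fin D.n → Bool} {j : Fin D.n} (h : D.IsStep ε ε' j) :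
    XCob (D.smoothingMan κ ε) (D.smoothingMan κ ε') :=
  κ.cob (D.resolution ε) (D.resolution ε') j (by simp [resolution, h.1, h.2.1])
    (fun i hi => by simp [resolution, h.2.2 i hi])

open Classical in
/-- The matrix entry `(-1)^{l(ε,ε')} τ(Σ_{ε → ε'})`, where `l(ε,ε')` is the number of `1`'s in `ε` in
front of the entry that changes; it vanishes if `ε'` does not arise from `ε` by a change of a
single entry from `0` to `1`. -/
noncomputable def entry (ε ε' : Fin D.n → Bool) :
    Q.A (D.smoothingMan κ ε) →ₗ[R] Q.A (D.smoothingMan κ ε') :=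
  ∑ j, if h : D.IsStep ε ε' j then
    ((-1 : R) ^ (Finset.univ.filter fun i => i < j ∧ ε i = true).card) • Q.τ (D.edgeCob κ h) else 0

/-- The complex `C_{(A,τ)}^*(F, D)`: in degree `i` the direct sum of the modules `A(D_ε)` with
`|ε| = i + n₋`. -/
noncomputable def complex : ModuleComplex.{v, w} R where
  C i := ∀ ε : {ε : Fin D.n → Bool // D.degree ε = i}, Q.A (D.smoothingMan κ ε.1)
  d i _ := LinearMap.pi fun ε' =>
    ∑ ε : {ε : Fin D.n → Bool // D.degree ε = i}, D.entry κ Q ε.1 ε'.1 ∘ₗ LinearMap.proj ε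

/-- The smoothing of `D^!` complementary to `ε`, of degree `-i` if `D_ε` has degree `i`. -/
def mirrorIndex {i : ℤ} (ε : {ε : Fin D.n → Bool // D.degree ε = i}) :
    {ε : Fin D.mirror.n → Bool // D.mirror.degree ε = -i} :=
  ⟨fun k => !ε.1 k, by rw [D.mirror_degree, ε.2]⟩

/-- The identification of `D^!_{1-ε}` with `D_ε`. -/
def mirrorHomeo (ε : Fin D.n → Bool) :
    XHomeo (D.mirror.smoothingMan κ (fun k => !ε k)) (D.smoothingMan κ ε) :=
  XHomeo.ofEq (congrArg κ.man (D.mirror_resolution ε))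

end LinkDiagram

/-! The duality is an adjunction. Three facts carry it.

First, the Frobenius pairing on `A(M)` is perfect. A cylinder can be cut along an S-shaped curve
into a cup, a cap and two straight cylinders (`XCob.isGluing_unitCylinder`), so the value of the
theory on the cup is a copairing `∑ x_k ⊗ y_k` with `a = ∑ η(y_k, a) x_k` for every `a`
(`HQFT.exists_copairing`). With the symmetry of `η` this gives `HQFT.pairing_bijective`.

Second, reading a cobordism `W : M → N` backwards gives the adjoint: `η(τ(W) a, b) = η(a, τ(W.flip)
b)` (`HQFT.pairing_τ_flip`). Both sides are the value on `a ⊗ b` of the same surface `W`, with its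
whole boundary taken as bottom base. To identify the left side with this value by the gluing axiom,
the bent cylinder over `N` has to be seen inside the surface. Instead of finding a collar of the
boundary in `W`, one attaches an outer collar; this does not change `τ`, since gluing on a cylinder
composes with the identity. The price is the proof that the collared space is again a surface
(`IsSurface.collar`).

Third, time reversal carries the saddle of `D^!` from the complement of `ε'` to the complement of
`ε` onto the saddle of `D` from `ε` to `ε'` (`LinkDiagram.τ_mirror_edgeCob`). Hence the matrix
entries of the two complexes are adjoint up to sign.

The signs can be absorbed. For a change of entry `j`, counted from zero, the `1`'s in front of `j`
in `ε` and in the complement of `ε'` number `j` together, so the two edge signs differ by `(-1)^j`.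
The product of `(-1)^i` over the entries `ε_i = 1` changes by exactly this factor
(`LinkDiagram.dualSign_mul_step`). The pairings multiplied by these products form the required
isomorphism. -/

/-! ### Attaching a collar to a surface -/

/-- The space obtained from `W` by attaching a cylinder along `B`. -/
def collar {W : Type} (B : Set W) : Set (W × I) := {x | x.2 = 0 ∨ x.1 ∈ B}

theorem IsClosed.collar {W : Type} [TopologicalSpace W] {B : Set W} (hB : IsClosed B) :
    IsClosed (collar B) :=
  (isClosed_singleton.preimage continuous_snd).union (hB.preimage continuous_fst)

section

variable {W : Type} [TopologicalSpace W] {B C : Set W} (e : OpenPartialHomeomorph W HalfPlane)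

/-- The chart of the collared surface away from the collar. -/
theorem isSurfaceAt_collar_off (x : collar B) (hx : x.1.1 ∈ e.source)
    (heB : ∀ q ∈ e.source, q ∉ B) (heC : ∀ q ∈ e.source, (q ∈ C ↔ (e q).1.2 = 0)) :
    IsSurfaceAt (collar B) {x | x.1.2 = 1 ∨ x.1.1 ∈ C} x := by
  have h0 : ∀ y : collar B, y.1.1 ∈ e.source → y.1.2 = 0 :=
    fun y hy => y.2.resolve_right (heB _ hy)
  refine ⟨{ toFun := fun y => e y.1.1
            invFun := fun z => ⟨(e.symm z, 0), Or.inl rfl⟩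
            source := {y | y.1.1 ∈ e.source}
            target := e.target
            map_source' := fun y hy => e.map_source hy
            map_target' := fun z hz => e.map_target hz
            left_inv' := fun y hy => Subtype.ext (Prod.ext (e.left_inv hy) (h0 y hy).symm)
            right_inv' := fun z hz => e.right_inv hz
            continuousOn_toFun := e.continuousOn.comp (by fun_prop) (fun y hy => hy)
            continuousOn_invFun := IsInducing.subtypeVal.continuousOn_iff.2
              (e.continuousOn_symm.prodMk continuousOn_const)
            open_source := e.open_source.preimage (by fun_prop)
            open_target := e.open_target }, hx, ?_⟩
  intro y hy
  refine Iff.trans ?_ (heC y.1.1 hy)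
  change y.1.2 = 1 ∨ y.1.1 ∈ C ↔ y.1.1 ∈ C
  simp [h0 y hy]

/-- The chart of the collared surface at the outer part of the collar. -/
theorem isSurfaceAt_collar_pos (x : collar B) (hx : x.1.1 ∈ e.source) (hx0 : 0 < x.1.2)
    (heC : ∀ q ∈ e.source, q ∉ C) (heB : ∀ q ∈ e.source, (q ∈ B ↔ (e q).1.2 = 0)) :
    IsSurfaceAt (collar B) {x | x.1.2 = 1 ∨ x.1.1 ∈ C} x := by
  classical
  -- Points at positive height lie over `B`, which `e` maps into the boundary line; `l` projects to
  -- that line and so fixes their images. The freed second coordinate becomes `1 - t`, which puts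
  -- the outer end `t = 1` of the collar on the boundary line.
  let l : HalfPlane → HalfPlane := fun z => ⟨(z.1.1, 0), le_refl _⟩
  have hl : Continuous l := by fun_prop
  have hB : ∀ y : collar B, 0 < y.1.2 → y.1.1 ∈ B := fun y hy => y.2.resolve_left hy.ne'
  have hmem : ∀ z, l z ∈ e.target → e.symm (l z) ∈ B := by
    intro z hz
    rw [heB _ (e.map_target hz), e.right_inv hz]
  refine ⟨{ toFun := fun y => ⟨((e y.1.1).1.1, 1 - (y.1.2 : ℝ)), sub_nonneg.2 y.1.2.2.2⟩
            invFun := fun z => if h : l z ∈ e.target then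
              ⟨(e.symm (l z), Set.projIcc 0 1 zero_le_one (1 - z.1.2)), Or.inr (hmem z h)⟩ else x
            source := {y | y.1.1 ∈ e.source ∧ 0 < y.1.2}
            target := {z | l z ∈ e.target ∧ z.1.2 < 1}
            map_source' := ?_
            map_target' := ?_
            left_inv' := ?_
            right_inv' := ?_
            continuousOn_toFun := ?_
            continuousOn_invFun := ?_
            open_source := ?_
            open_target := ?_ }, ⟨hx, hx0⟩, ?_⟩
  · rintro y ⟨h1, h2⟩
    have h3 : l (e y.1.1) = e y.1.1 :=
      Subtype.ext (Prod.ext rfl ((heB _ h1).1 (hB y h2)).symm)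
    refine ⟨?_, sub_lt_self _ h2⟩
    change l (e y.1.1) ∈ e.target
    rw [h3]
    exact e.map_source h1
  · rintro z ⟨h1, h2⟩
    rw [dif_pos h1]
    refine ⟨e.map_target h1, ?_⟩
    change 0 < Set.projIcc 0 1 zero_le_one (1 - z.1.2)
    rw [Set.projIcc_of_mem zero_le_one ⟨by linarith, by linarith [z.2]⟩]
    exact sub_pos.2 h2
  · rintro y ⟨h1, h2⟩
    have h3 : l (e y.1.1) = e y.1.1 :=
      Subtype.ext (Prod.ext rfl ((heB _ h1).1 (hB y h2)).symm)
    change (if h : l (e y.1.1) ∈ e.target then _ else _) = _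
    rw [dif_pos (h3 ▸ e.map_source h1)]
    refine Subtype.ext (Prod.ext ?_ ?_)
    · change e.symm (l (e y.1.1)) = _
      rw [h3, e.left_inv h1]
    · change Set.projIcc 0 1 zero_le_one (1 - (1 - (y.1.2 : ℝ))) = _
      rw [sub_sub_cancel, Set.projIcc_val]
  · rintro z ⟨h1, h2⟩
    rw [dif_pos h1]
    refine Subtype.ext (Prod.ext ?_ ?_)
    · change (e (e.symm (l z))).1.1 = z.1.1
      rw [e.right_inv h1]
    · change 1 - (Set.projIcc 0 1 zero_le_one (1 - z.1.2) : ℝ) = z.1.2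
      rw [Set.projIcc_of_mem zero_le_one ⟨by linarith, by linarith [z.2]⟩]
      exact sub_sub_cancel _ _
  · refine IsInducing.subtypeVal.continuousOn_iff.2 (ContinuousOn.prodMk ?_ (by fun_prop))
    exact (continuous_fst.comp continuous_subtype_val).comp_continuousOn
      (e.continuousOn.comp (by fun_prop) (fun y hy => hy.1))
  · refine IsInducing.subtypeVal.continuousOn_iff.2 ?_
    have h1 : ContinuousOn (fun z : HalfPlane =>
        (e.symm (l z), Set.projIcc 0 1 zero_le_one (1 - z.1.2)))
        {z | l z ∈ e.target ∧ z.1.2 < 1} :=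
      (e.continuousOn_symm.comp hl.continuousOn (fun z hz => hz.1)).prodMk
        (continuous_projIcc.comp (by fun_prop)).continuousOn
    refine h1.congr ?_
    intro z hz
    simp only [Function.comp]
    rw [dif_pos hz.1]
  · have h1 : IsOpen {y : collar B | 0 < y.1.2} := isOpen_lt (by fun_prop) (by fun_prop)
    exact (e.open_source.preimage (by fun_prop)).inter h1
  · have h1 : IsOpen {z : HalfPlane | z.1.2 < 1} := isOpen_lt (by fun_prop) (by fun_prop)
    exact (e.open_target.preimage hl).inter h1
  · rintro y ⟨h1, -⟩
    change y.1.2 = 1 ∨ y.1.1 ∈ C ↔ 1 - (y.1.2 : ℝ) = 0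
    simp only [heC _ h1, or_false]
    rw [sub_eq_zero, eq_comm, Subtype.ext_iff]
    exact Iff.rfl

/-- The chart of the collared surface where the collar is attached. -/
theorem isSurfaceAt_collar_lt (x : collar B) (hx : x.1.1 ∈ e.source) (hx1 : x.1.2 < 1)
    (heC : ∀ q ∈ e.source, q ∉ C) (heB : ∀ q ∈ e.source, (q ∈ B ↔ (e q).1.2 = 0)) :
    IsSurfaceAt (collar B) {x | x.1.2 = 1 ∨ x.1.1 ∈ C} x := by
  classical
  -- The half plane of the chart and the strip of the collar below it fit together to an open part
  -- of the plane. Since the height `t` or the second coordinate of `e` vanishes at each point, the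
  -- difference of the two determines both: they are its positive part (the role of `l`) and its
  -- negative part (the role of `projIcc`).
  let l : ℝ × ℝ → HalfPlane := fun z => ⟨(z.1, max z.2 0), le_max_right _ _⟩
  have hl : Continuous l := by fun_prop
  have hl' : ∀ y : collar B, y.1.1 ∈ e.source →
      l ((e y.1.1).1.1, (e y.1.1).1.2 - (y.1.2 : ℝ)) = e y.1.1 ∧
        Set.projIcc 0 1 zero_le_one (-((e y.1.1).1.2 - (y.1.2 : ℝ))) = y.1.2 := by
    intro y hy
    have h2 := (e y.1.1).2
    rcases y.2 with h | h
    · have h0 : ((y.1.2 : I) : ℝ) = 0 := by rw [h]; rfl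
      rw [h0, sub_zero]
      refine ⟨Subtype.ext (Prod.ext rfl (max_eq_left h2)), ?_⟩
      rw [Set.projIcc_of_le_left _ (by linarith), h]
      rfl
    · have h3 := (heB _ hy).1 h
      rw [h3, zero_sub, neg_neg, Set.projIcc_val]
      refine ⟨Subtype.ext (Prod.ext rfl ?_), rfl⟩
      change max (-(y.1.2 : ℝ)) 0 = _
      rw [max_eq_right (by linarith [y.1.2.2.1]), h3]
  have hmem : ∀ z, l z ∈ e.target →
      (e.symm (l z), Set.projIcc 0 1 zero_le_one (-z.2)) ∈ collar B := by
    intro z hz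
    rcases le_total 0 z.2 with h | h
    · left
      change Set.projIcc 0 1 zero_le_one (-z.2) = 0
      rw [Set.projIcc_of_le_left _ (by linarith)]
      rfl
    · right
      change e.symm (l z) ∈ B
      rw [heB _ (e.map_target hz), e.right_inv hz]
      exact max_eq_right h
  refine IsSurfaceAt.of_plane
    { toFun := fun y => ((e y.1.1).1.1, (e y.1.1).1.2 - (y.1.2 : ℝ))
      invFun := fun z => if h : l z ∈ e.target then
        ⟨(e.symm (l z), Set.projIcc 0 1 zero_le_one (-z.2)), hmem z h⟩ else x
      source := {y | y.1.1 ∈ e.source ∧ y.1.2 < 1}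
      target := {z | l z ∈ e.target ∧ -1 < z.2}
      map_source' := ?_
      map_target' := ?_
      left_inv' := ?_
      right_inv' := ?_
      continuousOn_toFun := ?_
      continuousOn_invFun := ?_
      open_source := ?_
      open_target := ?_ } ⟨hx, hx1⟩ ?_
  · rintro y ⟨h1, h2⟩
    refine ⟨?_, ?_⟩
    · rw [(hl' y h1).1]
      exact e.map_source h1
    · have h3 : (y.1.2 : ℝ) < 1 := h2
      change -1 < (e y.1.1).1.2 - (y.1.2 : ℝ)
      linarith [(e y.1.1).2]
  · rintro z ⟨h1, h2⟩
    rw [dif_pos h1]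
    refine ⟨e.map_target h1, ?_⟩
    change (Set.projIcc 0 1 zero_le_one (-z.2) : ℝ) < 1
    rw [Set.coe_projIcc]
    exact max_lt zero_lt_one (min_lt_of_right_lt (by linarith))
  · rintro y ⟨h1, h2⟩
    have h3 : l ((e y.1.1).1.1, (e y.1.1).1.2 - (y.1.2 : ℝ)) ∈ e.target := by
      rw [(hl' y h1).1]
      exact e.map_source h1
    rw [dif_pos h3]
    refine Subtype.ext (Prod.ext ?_ (hl' y h1).2)
    change e.symm (l _) = _
    rw [(hl' y h1).1, e.left_inv h1]
  · rintro z ⟨h1, h2⟩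
    rw [dif_pos h1]
    refine Prod.ext ?_ ?_
    · change (e (e.symm (l z))).1.1 = z.1
      rw [e.right_inv h1]
    · change (e (e.symm (l z))).1.2 - (Set.projIcc 0 1 zero_le_one (-z.2) : ℝ) = z.2
      rw [e.right_inv h1, Set.coe_projIcc]
      change max z.2 0 - _ = _
      rw [min_eq_right (by linarith)]
      grind
  · have h1 : ContinuousOn (fun y : collar B => (e y.1.1).1)
        {y : collar B | y.1.1 ∈ e.source ∧ y.1.2 < 1} :=
      continuous_subtype_val.comp_continuousOn
        (e.continuousOn.comp (by fun_prop) (fun y hy => hy.1))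
    exact h1.fst.prodMk (h1.snd.sub (by fun_prop))
  · refine IsInducing.subtypeVal.continuousOn_iff.2 ?_
    have h1 : ContinuousOn (fun z : ℝ × ℝ =>
        (e.symm (l z), Set.projIcc 0 1 zero_le_one (-z.2)))
        {z | l z ∈ e.target ∧ -1 < z.2} :=
      (e.continuousOn_symm.comp hl.continuousOn (fun z hz => hz.1)).prodMk
        (continuous_projIcc.comp (by fun_prop)).continuousOn
    refine h1.congr ?_
    intro z hz
    simp only [Function.comp]
    rw [dif_pos hz.1]
  · have h1 : IsOpen {y : collar B | y.1.2 < 1} := isOpen_lt (by fun_prop) (by fun_prop)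
    exact (e.open_source.preimage (by fun_prop)).inter h1
  · have h1 : IsOpen {z : ℝ × ℝ | -1 < z.2} := isOpen_lt (by fun_prop) (by fun_prop)
    exact (e.open_target.preimage hl).inter h1
  · rintro y ⟨h1, h2⟩ (h | h)
    · exact h2.ne h
    · exact heC _ h1 h

end

/-- A surface to which a collar is attached along a part of the boundary is a surface. -/
theorem IsSurface.collar {W : Type} [TopologicalSpace W] {B C : Set W}
    (hW : IsSurface W (B ∪ C)) (hB : IsClosed B) (hC : IsClosed C) (hBC : Disjoint B C) :
    IsSurface (collar B) {x | x.1.2 = 1 ∨ x.1.1 ∈ C} := by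
  intro x
  obtain ⟨e, he, heb⟩ := hW x.1.1
  -- As `B` and `C` are closed and disjoint, the chart can be shrunk until it misses one of them;
  -- then the boundary line corresponds to the other one alone.
  by_cases hx : x.1.1 ∈ B
  · have h1 : ∀ q ∈ (e.restrOpen Cᶜ hC.isOpen_compl).source, q ∉ C := fun q hq => hq.2
    have h2 : ∀ q ∈ (e.restrOpen Cᶜ hC.isOpen_compl).source,
        (q ∈ B ↔ ((e.restrOpen Cᶜ hC.isOpen_compl) q).1.2 = 0) := by
      intro q hq
      refine Iff.trans ?_ (heb q hq.1)
      simp [h1 q hq]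
    have h3 : x.1.1 ∈ (e.restrOpen Cᶜ hC.isOpen_compl).source :=
      ⟨he, Set.disjoint_left.1 hBC hx⟩
    rcases eq_or_ne x.1.2 0 with h | h
    · exact isSurfaceAt_collar_lt _ x h3 (by rw [h]; exact zero_lt_one) h1 h2
    · exact isSurfaceAt_collar_pos _ x h3 (unitInterval.pos_iff_ne_zero.2 h) h1 h2
  · have h1 : ∀ q ∈ (e.restrOpen Bᶜ hB.isOpen_compl).source, q ∉ B := fun q hq => hq.2
    refine isSurfaceAt_collar_off (e.restrOpen Bᶜ hB.isOpen_compl) x ⟨he, hx⟩ h1 ?_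
    intro q hq
    refine Iff.trans ?_ (heb q hq.1)
    simp [h1 q hq]

/-! ### Reversing, bending and gluing cobordisms -/

namespace XCob

variable {X : Type u} [TopologicalSpace X] {x₀ : X} {M N : XMan X x₀}

/-- The cylinder `M × [0,1]` with characteristic map constant along `[0,1]`. -/
def idCob (M : XMan X x₀) : XCob M M :=
  cylinder M (M.g.comp ⟨Prod.fst, continuous_fst⟩) (fun _ => rfl) (fun _ => rfl)

theorem bot_injective (W : XCob M N) : Function.Injective W.bot :=
  W.bd_injective.comp Sum.inl_injective

theorem tp_injective (W : XCob M N) : Function.Injective W.tp :=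
  W.bd_injective.comp Sum.inr_injective

theorem bot_ne_tp (W : XCob M N) (p : M.carrier) (q : N.carrier) : W.bot p ≠ W.tp q :=
  W.bd_injective.ne (Sum.inl_ne_inr (a := p) (b := q))

theorem disjoint_range (W : XCob M N) : Disjoint (Set.range W.bot) (Set.range W.tp) := by
  rw [Set.disjoint_left]
  rintro _ ⟨p, rfl⟩ ⟨q, hq⟩
  exact W.bot_ne_tp p q hq.symm

/-- A cobordism read from top to bottom. -/
def flip (W : XCob M N) : XCob N M where
  carrier := W.carrier
  bot := W.tp
  tp := W.bot
  bd_injective := W.tp_injective.sumElim W.bot_injective fun p q => (W.bot_ne_tp q p).symm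
  isSurface := by
    convert W.isSurface using 1
    rw [Set.Sum.elim_range, Set.Sum.elim_range, Set.union_comm]
  g := W.g
  g_bot := W.g_tp
  g_tp := W.g_bot

/-- A cobordism from `M` to `N` regarded as a cobordism from `M ⊔ N` to the empty manifold. -/
def bend (W : XCob M N) : XCob (M.sum N) (XMan.empty : XMan X x₀) where
  carrier := W.carrier
  bot := ⟨Sum.elim W.bot W.tp, W.bot.continuous.sumElim W.tp.continuous⟩
  tp := ⟨fun p => p.elim, continuous_of_discreteTopology (α := Empty)⟩
  bd_injective := by
    rintro (p | p) (q | q) h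
    · exact congrArg Sum.inl (W.bd_injective h)
    all_goals first | exact p.elim | exact q.elim
  isSurface := by
    convert W.isSurface using 1
    ext x
    constructor
    · rintro ⟨p | p, rfl⟩
      · exact ⟨p, rfl⟩
      · exact p.elim
    · rintro ⟨p, rfl⟩
      exact ⟨Sum.inl p, rfl⟩
  g := W.g
  g_bot := by
    rintro (p | p)
    · exact W.g_bot p
    · exact W.g_tp p
  g_tp p := p.elim

/-- A cobordism with a collar attached to its bottom base. -/
def collarBot (W : XCob M N) : XCob M N where
  carrier := collar (Set.range W.bot)
  compact := isCompact_iff_compactSpace.1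
    (isCompact_range W.bot.continuous).isClosed.collar.isCompact
  bot := ⟨fun p => ⟨(W.bot p, 1), Or.inr ⟨p, rfl⟩⟩, by fun_prop⟩
  tp := ⟨fun p => ⟨(W.tp p, 0), Or.inl rfl⟩, by fun_prop⟩
  bd_injective := by
    refine Function.Injective.sumElim ?_ ?_ ?_
    · intro p q h
      exact W.bot_injective (congrArg (fun x => x.1.1) h)
    · intro p q h
      exact W.tp_injective (congrArg (fun x => x.1.1) h)
    · intro p q h
      exact one_ne_zero (congrArg (fun x => x.1.2) h)
  isSurface := by
    have h := W.isSurface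
    rw [Set.Sum.elim_range] at h
    convert h.collar (isCompact_range W.bot.continuous).isClosed
      (isCompact_range W.tp.continuous).isClosed W.disjoint_range using 1
    ext x
    constructor
    · rintro ⟨p | p, rfl⟩
      · exact Or.inl rfl
      · exact Or.inr ⟨p, rfl⟩
    -- Height `1` excludes the copy of `W` at height `0`, so such a point lies over the bottom base.
    -- A point over the top base does not lie over the bottom base, so its height is `0`.
    · rintro (h | ⟨p, h⟩)
      · rcases x.2 with h0 | ⟨p, hp⟩
        · exact absurd (h0.symm.trans h) zero_ne_one
        · exact ⟨Sum.inl p, Subtype.ext (Prod.ext hp h.symm)⟩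
      · rcases x.2 with h0 | ⟨q, hq⟩
        · exact ⟨Sum.inr p, Subtype.ext (Prod.ext h h0.symm)⟩
        · exact absurd (hq.trans h.symm) (W.bot_ne_tp q p)
  g := ⟨fun x => W.g x.1.1, by fun_prop⟩
  g_bot p := W.g_bot p
  g_tp p := W.g_tp p

/-- The cylinder enters upside down: its bottom is the outer end of the collar, at height `1`, and
its top is the seam at height `0`, where `W` begins. -/
theorem isGluing_collarBot (W : XCob M N) :
    IsGluing (idCob M) (XHomeo.ofEq rfl) W (collarBot W) := by
  refine ⟨⟨fun x : M.carrier × I => (⟨(W.bot x.1, unitInterval.symm x.2), Or.inr ⟨x.1, rfl⟩⟩ :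
      collar (Set.range W.bot)), by fun_prop⟩,
    ⟨fun x => (⟨(x, 0), Or.inl rfl⟩ : collar (Set.range W.bot)), by fun_prop⟩,
    ?_, ?_, ?_, ?_, ?_, fun _ => rfl, ?_, fun _ => rfl⟩
  · rintro ⟨p, s⟩ ⟨q, t⟩ h
    have h1 : W.bot p = W.bot q := congrArg (fun x => x.1.1) h
    have h2 : unitInterval.symm s = unitInterval.symm t := congrArg (fun x => x.1.2) h
    exact Prod.ext (W.bot_injective h1) (unitInterval.symm_bijective.injective h2)
  · intro p q h
    exact congrArg (fun x => x.1.1) h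
  · refine Set.eq_univ_of_forall fun x => ?_
    rcases x.2 with h | ⟨p, h⟩
    · exact Or.inr ⟨x.1.1, Subtype.ext (Prod.ext rfl h.symm)⟩
    · exact Or.inl ⟨(p, unitInterval.symm x.1.2),
        Subtype.ext (Prod.ext h (unitInterval.symm_symm _))⟩
  · rintro ⟨p, t⟩ b
    constructor
    · intro h
      have h1 : W.bot p = b := congrArg (fun x => x.1.1) h
      have h2 : unitInterval.symm t = 0 := congrArg (fun x => x.1.2) h
      refine ⟨p, Prod.ext rfl ?_, h1.symm⟩
      rwa [unitInterval.symm_eq_zero] at h2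
    · rintro ⟨n, h1, rfl⟩
      obtain ⟨rfl, rfl⟩ := Prod.mk.inj h1
      exact Subtype.ext (Prod.ext rfl unitInterval.symm_one)
  · intro p
    exact Subtype.ext (Prod.ext rfl unitInterval.symm_zero)
  · rintro ⟨p, t⟩
    exact W.g_bot p

/-- The collar over `N` is cut at height `1/2`. Its lower half is the bent cylinder, which joins the
top base of `W` at height `0` to the cut; its upper half is the straight cylinder from the outer end
down to the cut. What remains is `W` with its collar over `M`. -/
theorem isGluing_collarBot_bend (W : XCob M N) :
    IsGluing ((collarBot W).sum (idCob N)) (XHomeo.ofEq rfl) (bentCylinder N)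
      (collarBot (bend W)) := by
  have hsub : Set.range W.bot ⊆ Set.range (bend W).bot := by
    rintro _ ⟨p, rfl⟩
    exact ⟨Sum.inl p, rfl⟩
  -- `k` runs from height `1` down to `1/2` and places the straight cylinder; `l` runs from `0` up
  -- to `1/2` and places the bent one. Their ranges meet only at the common end `k 1 = l 1`.
  let k : I → I := fun t => ⟨1 - t / 2, by linarith [t.2.2], by linarith [t.2.1]⟩
  let l : I → I := fun t => ⟨t / 2, by linarith [t.2.1], by linarith [t.2.2]⟩
  have hk : Continuous k := by fun_prop
  have hl : Continuous l := by fun_prop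
  have hkl : ∀ s t, k s = l t → s = 1 ∧ t = 1 := by
    intro s t h
    have h1 : 1 - (s : ℝ) / 2 = t / 2 := congrArg Subtype.val h
    exact ⟨Subtype.ext (by change (s : ℝ) = 1; linarith [s.2.2, t.2.2]),
      Subtype.ext (by change (t : ℝ) = 1; linarith [s.2.2, t.2.2])⟩
  have hkl1 : k 1 = l 1 := Subtype.ext (by simp only [k, l]; norm_num)
  have hk0 : k 0 = 1 := Subtype.ext (by simp [k])
  have hl0 : l 0 = 0 := Subtype.ext (by simp [l])
  have hkp : ∀ s, k s ≠ 0 := by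
    intro s h
    have h1 : 1 - (s : ℝ) / 2 = 0 := congrArg Subtype.val h
    linarith [s.2.2]
  let j₀ : (collarBot W).carrier ⊕ (N.carrier × I) → (collarBot (bend W)).carrier :=
    Sum.elim (fun x : collar (Set.range W.bot) => (⟨x.1, x.2.imp id fun h => hsub h⟩ :
        collar (Set.range (bend W).bot)))
      (fun x : N.carrier × I => (⟨(W.tp x.1, k x.2), Or.inr ⟨Sum.inr x.1, rfl⟩⟩ :
        collar (Set.range (bend W).bot)))
  let j₁ : N.carrier × I → (collarBot (bend W)).carrier :=
    fun x => (⟨(W.tp x.1, l x.2), Or.inr ⟨Sum.inr x.1, rfl⟩⟩ :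
        collar (Set.range (bend W).bot))
  have hj₀ : Continuous j₀ := by
    refine Continuous.sumElim ?_ ?_
    · exact continuous_subtype_val.subtype_mk _
    · exact ((W.tp.continuous.comp continuous_fst).prodMk (hk.comp continuous_snd)).subtype_mk _
  have hj₁ : Continuous j₁ :=
    ((W.tp.continuous.comp continuous_fst).prodMk (hl.comp continuous_snd)).subtype_mk _
  -- Over the top base `collarBot W` has no collar, so it meets the collar over `N` at height `0`
  -- only. There it touches the bent cylinder, and it misses the straight one, as `k` is never `0`.
  have htp : ∀ (x : collar (Set.range W.bot)) q, x.1.1 = W.tp q → x.1.2 = 0 := by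
    rintro x q hq
    refine x.2.resolve_right ?_
    rintro ⟨p, hp⟩
    exact W.bot_ne_tp p q (hp.trans hq)
  refine ⟨⟨j₀, hj₀⟩, ⟨j₁, hj₁⟩, ?_, ?_, ?_, ?_, ?_, fun p => p.elim, ?_, ?_⟩
  · rintro (x | ⟨p, s⟩) (y | ⟨q, t⟩) h
    · have h1 : x.1 = y.1 := congrArg (fun x => x.1) h
      exact congrArg Sum.inl (Subtype.ext h1)
    · have h1 : x.1.1 = W.tp q := congrArg (fun x => x.1.1) h
      have h2 : x.1.2 = k t := congrArg (fun x => x.1.2) h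
      exact absurd (h2.symm.trans (htp _ _ h1)) (hkp t)
    · have h1 : W.tp p = y.1.1 := congrArg (fun x => x.1.1) h
      have h2 : k s = y.1.2 := congrArg (fun x => x.1.2) h
      exact absurd (h2.trans (htp _ _ h1.symm)) (hkp s)
    · have h1 : W.tp p = W.tp q := congrArg (fun x => x.1.1) h
      have h2 : k s = k t := congrArg (fun x => x.1.2) h
      have h3 : 1 - (s : ℝ) / 2 = 1 - (t : ℝ) / 2 := congrArg Subtype.val h2
      exact congrArg Sum.inr (Prod.ext (W.tp_injective h1) (Subtype.ext (by linarith)))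
  · rintro ⟨p, s⟩ ⟨q, t⟩ h
    have h1 : W.tp p = W.tp q := congrArg (fun x => x.1.1) h
    have h2 : l s = l t := congrArg (fun x => x.1.2) h
    have h3 : (s : ℝ) / 2 = (t : ℝ) / 2 := congrArg Subtype.val h2
    exact Prod.ext (W.tp_injective h1) (Subtype.ext (by linarith))
  · refine Set.eq_univ_of_forall fun x => ?_
    rcases x.2 with h | ⟨p | p, h⟩
    · exact Or.inl ⟨Sum.inl ⟨x.1, Or.inl h⟩, rfl⟩
    · exact Or.inl ⟨Sum.inl ⟨x.1, Or.inr ⟨p, h⟩⟩, rfl⟩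
    · rcases le_total (x.1.2 : ℝ) (1 / 2) with h2 | h2
      · refine Or.inr ⟨(p, ⟨2 * x.1.2, by linarith [x.1.2.2.1], by linarith⟩), ?_⟩
        refine Subtype.ext (Prod.ext h (Subtype.ext ?_))
        change 2 * (x.1.2 : ℝ) / 2 = x.1.2
        ring
      · refine Or.inl ⟨Sum.inr (p, ⟨2 * (1 - x.1.2), by linarith [x.1.2.2.2], by linarith⟩), ?_⟩
        refine Subtype.ext (Prod.ext h (Subtype.ext ?_))
        change 1 - 2 * (1 - (x.1.2 : ℝ)) / 2 = x.1.2
        ring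
  · intro a b
    constructor
    · obtain ⟨q, t⟩ := b
      rcases a with x | ⟨p, s⟩ <;> intro h
      · have h1 : x.1.1 = W.tp q := congrArg (fun x => x.1.1) h
        have h2 : x.1.2 = l t := congrArg (fun x => x.1.2) h
        have h0 := htp _ _ h1
        have h3 : (t : ℝ) / 2 = 0 := congrArg Subtype.val (h2.symm.trans h0)
        refine ⟨Sum.inl q, congrArg Sum.inl (Subtype.ext (Prod.ext h1 h0)),
          Prod.ext rfl (Subtype.ext ?_)⟩
        change (t : ℝ) = 0
        linarith
      · have h1 : W.tp p = W.tp q := congrArg (fun x => x.1.1) h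
        have h2 : k s = l t := congrArg (fun x => x.1.2) h
        obtain ⟨rfl, rfl⟩ := hkl _ _ h2
        obtain rfl := W.tp_injective h1
        exact ⟨Sum.inr p, rfl, rfl⟩
    · rintro ⟨n | n, rfl, rfl⟩
      · exact Subtype.ext (Prod.ext rfl hl0.symm)
      · exact Subtype.ext (Prod.ext rfl hkl1)
  · rintro (p | p)
    · rfl
    · exact Subtype.ext (Prod.ext rfl hk0)
  · rintro (x | ⟨p, s⟩)
    · rfl
    · exact W.g_tp p
  · rintro ⟨p, s⟩
    exact W.g_tp p

/-- The cylinder over `M` as a cobordism from `∅ ⊔ M` to `M ⊔ ∅`. -/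
def unitCylinder (M : XMan X x₀) : XCob (XMan.empty.sum M) (M.sum XMan.empty) where
  carrier := M.carrier × I
  bot := ⟨Sum.elim (fun p => p.elim) (fun p => (p, 0)),
    Continuous.sumElim (continuous_of_discreteTopology (α := Empty)) (by fun_prop)⟩
  tp := ⟨Sum.elim (fun p => (p, 1)) (fun p => p.elim),
    Continuous.sumElim (by fun_prop) (continuous_of_discreteTopology (α := Empty))⟩
  bd_injective := by
    rintro ((p | p) | (p | p)) ((q | q) | (q | q)) h
    all_goals try exact p.elim
    all_goals try exact q.elim
    · rw [show p = q from congrArg Prod.fst h]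
    · exact absurd (congrArg Prod.snd h) zero_ne_one
    · exact absurd (congrArg Prod.snd h) one_ne_zero
    · rw [show p = q from congrArg Prod.fst h]
  isSurface := by
    convert M.isCurve.prod_I using 1
    ext ⟨p, t⟩
    constructor
    · rintro ⟨(q | q) | (q | q), h⟩
      · exact q.elim
      · exact Or.inl (congrArg Prod.snd h).symm
      · exact Or.inr (congrArg Prod.snd h).symm
      · exact q.elim
    · rintro (h | h)
      · exact ⟨Sum.inl (Sum.inr p), Prod.ext rfl h.symm⟩
      · exact ⟨Sum.inr (Sum.inl p), Prod.ext rfl h.symm⟩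
  g := M.g.comp ⟨Prod.fst, continuous_fst⟩
  g_bot := by
    rintro (p | p)
    · exact p.elim
    · rfl
  g_tp := by
    rintro (p | p)
    · rfl
    · exact p.elim

/-- The decomposition of the cylinder given by an S-shaped curve. -/
theorem isGluing_unitCylinder (M : XMan X x₀) :
    IsGluing ((bentCylinder M).flip.sum (idCob M)) (XHomeo.sumAssoc M M M)
      ((idCob M).sum (bentCylinder M)) (unitCylinder M) := by
  -- The cuts are at heights `3/4`, `1/2` and `1/4`, which are the three copies of `M` in the middle
  -- manifold, in this order. `a₁` sends the cup to `[1/2, 3/4]` and `b₂` the cap to `[1/4, 1/2]`,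
  -- both downwards so that their ends match this order; `a₂` and `b₁` send the straight cylinders
  -- upwards to `[0, 1/4]` and `[3/4, 1]`.
  let a₁ : I → I := fun t => ⟨3 / 4 - t / 4, by linarith [t.2.2], by linarith [t.2.1]⟩
  let a₂ : I → I := fun t => ⟨t / 4, by linarith [t.2.1], by linarith [t.2.2]⟩
  let b₁ : I → I := fun t => ⟨3 / 4 + t / 4, by linarith [t.2.1], by linarith [t.2.2]⟩
  let b₂ : I → I := fun t => ⟨1 / 2 - t / 4, by linarith [t.2.2], by linarith [t.2.1]⟩
  let j₀ : (M.carrier × I) ⊕ (M.carrier × I) → M.carrier × I :=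
    Sum.elim (Prod.map id a₁) (Prod.map id a₂)
  let j₁ : (M.carrier × I) ⊕ (M.carrier × I) → M.carrier × I :=
    Sum.elim (Prod.map id b₁) (Prod.map id b₂)
  have hj₀ : Continuous j₀ := Continuous.sumElim
    (continuous_id.prodMap (by fun_prop)) (continuous_id.prodMap (by fun_prop))
  have hj₁ : Continuous j₁ := Continuous.sumElim
    (continuous_id.prodMap (by fun_prop)) (continuous_id.prodMap (by fun_prop))
  have z : ∀ t : I, (t : ℝ) = 0 → t = 0 := fun t h => Subtype.ext h
  have o : ∀ t : I, (t : ℝ) = 1 → t = 1 := fun t h => Subtype.ext h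
  refine ⟨⟨j₀, hj₀⟩, ⟨j₁, hj₁⟩, ?_, ?_, ?_, ?_, ?_, ?_, ?_, ?_⟩
  · rintro (⟨p, s⟩ | ⟨p, s⟩) (⟨q, t⟩ | ⟨q, t⟩) h <;>
      obtain rfl : p = q := congrArg Prod.fst h
    · have h1 : 3 / 4 - (s : ℝ) / 4 = 3 / 4 - t / 4 := congrArg (fun x => (x.2 : ℝ)) h
      rw [show s = t from Subtype.ext (by linarith)]
    · have h1 : 3 / 4 - (s : ℝ) / 4 = t / 4 := congrArg (fun x => (x.2 : ℝ)) h
      linarith [s.2.2, t.2.2]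
    · have h1 : (s : ℝ) / 4 = 3 / 4 - t / 4 := congrArg (fun x => (x.2 : ℝ)) h
      linarith [s.2.2, t.2.2]
    · have h1 : (s : ℝ) / 4 = t / 4 := congrArg (fun x => (x.2 : ℝ)) h
      rw [show s = t from Subtype.ext (by linarith)]
  · rintro (⟨p, s⟩ | ⟨p, s⟩) (⟨q, t⟩ | ⟨q, t⟩) h <;>
      obtain rfl : p = q := congrArg Prod.fst h
    · have h1 : 3 / 4 + (s : ℝ) / 4 = 3 / 4 + t / 4 := congrArg (fun x => (x.2 : ℝ)) h
      rw [show s = t from Subtype.ext (by linarith)]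
    · have h1 : 3 / 4 + (s : ℝ) / 4 = 1 / 2 - t / 4 := congrArg (fun x => (x.2 : ℝ)) h
      linarith [s.2.1, t.2.1]
    · have h1 : 1 / 2 - (s : ℝ) / 4 = 3 / 4 + t / 4 := congrArg (fun x => (x.2 : ℝ)) h
      linarith [s.2.1, t.2.1]
    · have h1 : 1 / 2 - (s : ℝ) / 4 = 1 / 2 - t / 4 := congrArg (fun x => (x.2 : ℝ)) h
      rw [show s = t from Subtype.ext (by linarith)]
  · refine Set.eq_univ_of_forall ?_
    rintro ⟨p, t⟩
    have h0 := t.2.1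
    have h1 := t.2.2
    rcases le_total (t : ℝ) (1 / 4) with h | h
    · exact Or.inl ⟨Sum.inr (p, ⟨4 * t, by linarith, by linarith⟩),
        Prod.ext rfl (Subtype.ext (show 4 * (t : ℝ) / 4 = t by ring))⟩
    rcases le_total (t : ℝ) (1 / 2) with h' | h'
    · exact Or.inr ⟨Sum.inr (p, ⟨2 - 4 * t, by linarith, by linarith⟩),
        Prod.ext rfl (Subtype.ext (show 1 / 2 - (2 - 4 * (t : ℝ)) / 4 = t by ring))⟩
    rcases le_total (t : ℝ) (3 / 4) with h'' | h''
    · exact Or.inl ⟨Sum.inl (p, ⟨3 - 4 * t, by linarith, by linarith⟩),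
        Prod.ext rfl (Subtype.ext (show 3 / 4 - (3 - 4 * (t : ℝ)) / 4 = t by ring))⟩
    · exact Or.inr ⟨Sum.inl (p, ⟨4 * t - 3, by linarith, by linarith⟩),
        Prod.ext rfl (Subtype.ext (show 3 / 4 + (4 * (t : ℝ) - 3) / 4 = t by ring))⟩
  · intro a b
    constructor
    · rcases a with ⟨p, s⟩ | ⟨p, s⟩ <;> rcases b with ⟨q, t⟩ | ⟨q, t⟩ <;> intro h <;>
        obtain rfl : p = q := congrArg Prod.fst h <;> have s0 := s.2.1 <;> have s1 := s.2.2 <;>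
        have t0 := t.2.1 <;> have t1 := t.2.2
      · have h1 : 3 / 4 - (s : ℝ) / 4 = 3 / 4 + t / 4 := congrArg (fun x => (x.2 : ℝ)) h
        obtain rfl := z s (by linarith)
        obtain rfl := z t (by linarith)
        exact ⟨Sum.inl (Sum.inl p), rfl, rfl⟩
      · have h1 : 3 / 4 - (s : ℝ) / 4 = 1 / 2 - t / 4 := congrArg (fun x => (x.2 : ℝ)) h
        obtain rfl := o s (by linarith)
        obtain rfl := z t (by linarith)
        exact ⟨Sum.inl (Sum.inr p), rfl, rfl⟩
      · have h1 : (s : ℝ) / 4 = 3 / 4 + t / 4 := congrArg (fun x => (x.2 : ℝ)) h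
        linarith
      · have h1 : (s : ℝ) / 4 = 1 / 2 - t / 4 := congrArg (fun x => (x.2 : ℝ)) h
        obtain rfl := o s (by linarith)
        obtain rfl := o t (by linarith)
        exact ⟨Sum.inr p, rfl, rfl⟩
    · rintro ⟨(n | n) | n, rfl, rfl⟩
      · refine Prod.ext rfl (Subtype.ext ?_)
        change 3 / 4 - (0 : ℝ) / 4 = 3 / 4 + 0 / 4
        norm_num
      · refine Prod.ext rfl (Subtype.ext ?_)
        change 3 / 4 - (1 : ℝ) / 4 = 1 / 2 - 0 / 4
        norm_num
      · refine Prod.ext rfl (Subtype.ext ?_)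
        change (1 : ℝ) / 4 = 1 / 2 - 1 / 4
        norm_num
  · rintro (p | p)
    · exact p.elim
    · refine Prod.ext rfl (Subtype.ext ?_)
      change (0 : ℝ) / 4 = 0
      norm_num
  · rintro (p | p)
    · refine Prod.ext rfl (Subtype.ext ?_)
      change 3 / 4 + (1 : ℝ) / 4 = 1
      norm_num
    · exact p.elim
  · rintro (⟨p, s⟩ | ⟨p, s⟩) <;> rfl
  · rintro (⟨p, s⟩ | ⟨p, s⟩) <;> rfl

end XCob

/-! ### The Frobenius pairing: perfectness and adjoints -/

namespace HQFT

variable {X : Type u} [TopologicalSpace X] {x₀ : X} {R : Type v} [CommRing R]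
  (Q : HQFT.{u, v, w} X x₀ R) {M N : XMan X x₀}

/-- An injective idempotent map is the identity, and functoriality makes this one idempotent. -/
theorem map_ofEq_refl (M : XMan X x₀) (a : Q.A M) : Q.map (XHomeo.ofEq (rfl : M = M)) a = a :=
  (Q.map (XHomeo.ofEq (rfl : M = M))).injective
    (Q.map_trans (XHomeo.ofEq (rfl : M = M)) (XHomeo.ofEq rfl) a).symm

theorem τ_idCob (M : XMan X x₀) (a : Q.A M) : Q.τ (XCob.idCob M) a = a :=
  Q.τ_cylinder M _ _ _ (fun b hb _ => M.g_base b hb) a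

theorem pairing_apply (M : XMan X x₀) (a b : Q.A M) :
    Q.pairing M a b =
      Q.emptyEquiv (Q.τ (XCob.bentCylinder M) (Q.sumEquiv M M (a ⊗ₜ b))) := rfl

/-- The reflection of `[0,1]` is a homeomorphism of the bent cylinder that exchanges its two ends
and preserves the characteristic map. -/
theorem pairing_comm (M : XMan X x₀) (a b : Q.A M) : Q.pairing M a b = Q.pairing M b a := by
  have h := Q.τ_natural (XCob.bentCylinder M) (XCob.bentCylinder M) (XHomeo.sumComm M M)
    (XHomeo.ofEq rfl) ((Homeomorph.refl M.carrier).prodCongr unitInterval.symmHomeomorph)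
    (by
      rintro (p | p)
      · exact Prod.ext rfl unitInterval.symm_zero
      · exact Prod.ext rfl unitInterval.symm_one)
    (fun p => p.elim) (fun _ => rfl) (Q.sumEquiv M M (a ⊗ₜ b))
  rw [sumEquiv_comm, map_ofEq_refl] at h
  rw [pairing_apply, pairing_apply, h]

/-- The pairing has a copairing. -/
theorem exists_copairing (M : XMan X x₀) : ∃ S : Finset (Q.A M × Q.A M),
    ∀ a, ∑ i ∈ S, Q.pairing M i.2 a • i.1 = a := by
  -- The copairing is the image of the generator of `A(∅)` under the reversed bent cylinder; `S`
  -- lists the pure tensors of which it is the sum.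
  let e := Q.emptyEquiv.symm 1
  obtain ⟨S, hS⟩ := TensorProduct.exists_finset
    ((Q.sumEquiv M M).symm (Q.τ (XCob.bentCylinder M).flip e))
  refine ⟨S, fun a => ?_⟩
  -- Up to the removal of empty parts the `unitCylinder` is the identity cobordism, so it sends `e ⊗
  -- a` to `a`. Evaluated through its S-shaped decomposition, it sends `e ⊗ a` to the sum of the
  -- `η(i.2, a) i.1`.
  have h1 := Q.τ_natural (XCob.unitCylinder M) (XCob.idCob M)
    ((XHomeo.sumComm XMan.empty M).trans (XHomeo.sumEmpty M)) (XHomeo.sumEmpty M)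
    (Homeomorph.refl (M.carrier × I))
    (by
      rintro (p | p)
      · exact p.elim
      · rfl)
    (by
      rintro (p | p)
      · rfl
      · exact p.elim)
    (fun _ => rfl) (Q.sumEquiv XMan.empty M (e ⊗ₜ a))
  rw [τ_idCob, map_trans, sumEquiv_comm, sumEquiv_empty, LinearEquiv.apply_symm_apply, one_smul,
    Q.τ_glue _ _ _ _ (XCob.isGluing_unitCylinder M), τ_sum, τ_idCob,
    ← (Q.sumEquiv M M).apply_symm_apply (Q.τ _ e), hS, map_sum, TensorProduct.sum_tmul,
    map_sum, map_sum, map_sum, map_sum] at h1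
  refine (Finset.sum_congr rfl fun i _ => ?_).trans h1.symm
  rw [sumEquiv_assoc, τ_sum, τ_idCob, sumEquiv_empty, pairing_apply]

/-- If `η(a, ·) = 0`, then all coefficients in the expansion of `a` by the copairing vanish, by
symmetry. A form `φ`, applied to the expansion of `y`, becomes `η(∑ φ(i.1) i.2, y)`, which exhibits
a preimage. -/
theorem pairing_bijective (M : XMan X x₀) : Function.Bijective (Q.pairing M) := by
  obtain ⟨S, hS⟩ := Q.exists_copairing M
  constructor
  · rw [injective_iff_map_eq_zero]
    intro a ha
    rw [← hS a]
    refine Finset.sum_eq_zero fun i _ => ?_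
    rw [pairing_comm, ha, LinearMap.zero_apply, zero_smul]
  · intro φ
    refine ⟨∑ i ∈ S, φ i.1 • i.2, LinearMap.ext fun y => ?_⟩
    conv_rhs => rw [← hS y]
    simp [mul_comm]

theorem τ_collarBot (W : XCob M N) (a : Q.A M) : Q.τ W.collarBot a = Q.τ W a := by
  rw [Q.τ_glue _ _ _ _ W.isGluing_collarBot, τ_idCob, map_ofEq_refl]

/-- The left side is the value on `W ⊔ (N × [0,1])` followed by the bent cylinder. After collars are
attached, which `τ` does not see, this composite is literally the bent surface. -/
theorem pairing_τ (W : XCob M N) (a : Q.A M) (b : Q.A N) :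
    Q.pairing N (Q.τ W a) b = Q.emptyEquiv (Q.τ W.bend (Q.sumEquiv M N (a ⊗ₜ b))) := by
  rw [← τ_collarBot Q W.bend, Q.τ_glue _ _ _ _ W.isGluing_collarBot_bend, map_ofEq_refl, τ_sum,
    τ_idCob, τ_collarBot, pairing_apply]

/-- The homomorphism of the reversed cobordism is the adjoint for the Frobenius pairing. -/
theorem pairing_τ_flip (W : XCob M N) (a : Q.A M) (b : Q.A N) :
    Q.pairing N (Q.τ W a) b = Q.pairing M a (Q.τ W.flip b) := by
  -- Bending `W` and bending `W.flip` give the same surface with the same map; only the two parts of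
  -- the bottom base are exchanged.
  have h := Q.τ_natural W.bend W.flip.bend (XHomeo.sumComm M N)
    (XHomeo.ofEq rfl) (Homeomorph.refl W.carrier)
    (by rintro (p | p) <;> rfl)
    (fun p => p.elim) (fun _ => rfl) (Q.sumEquiv M N (a ⊗ₜ b))
  rw [sumEquiv_comm, map_ofEq_refl] at h
  rw [pairing_comm Q M a, pairing_τ, pairing_τ, h]

end HQFT

/-! ### Saddles of the mirror image as reversed saddles -/

/-- The substitution `t ↦ 1 - t` exchanges `1 - 2t` and `2t - 1`, and so exchanges the equations of
the two saddles. -/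
theorem saddleModel_not (b : Bool) (z : ℝ × ℝ) (t : I) :
    (z, t) ∈ saddleModel (!b) ↔ (z, unitInterval.symm t) ∈ saddleModel b := by
  have e1 : 1 - 2 * (1 - (t : ℝ)) = 2 * (t : ℝ) - 1 := by ring
  have e2 : 2 * (1 - (t : ℝ)) - 1 = 1 - 2 * (t : ℝ) := by ring
  cases b <;> simp [saddleModel, e1, e2, eq_comm]

theorem LinkProjection.mem_trace_symm {F : Type} [TopologicalSpace F] {bd : Set F}
    {o : SurfaceOrientation F} (P : LinkProjection F bd o) {ρ ρ' : Fin P.n → Bool} {j : Fin P.n}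
    (hj : ρ' j = !ρ j) (hne : ∀ i, i ≠ j → ρ' i = ρ i) (q : F) (t : I) :
    (q, t) ∈ P.trace ρ' j ↔ (q, unitInterval.symm t) ∈ P.trace ρ j := by
  by_cases h : q ∈ Set.range (P.box j)
  · obtain ⟨z, rfl⟩ := h
    rw [P.mem_trace_box, P.mem_trace_box, hj, saddleModel_not]
  · have h' : q ∉ P.box j '' square := fun h1 => h (Set.image_subset_range _ _ h1)
    -- Away from the box both traces are cylinders, over smoothings that agree there. The agreement
    -- is read off from the time-`1` end of the trace of `ρ`, which is the smoothing `ρ'`.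
    rw [P.mem_trace_off ρ' j t h', P.mem_trace_off ρ j _ h', ← P.mem_trace_one ρ ρ' j hj hne,
      P.mem_trace_off ρ j 1 h']

/-- The transport along an equality of resolutions does not move the points of `F`; this makes the
identification of `D^!_{1-ε}` with `D_ε` usable in coordinates. -/
theorem Coloring.coe_ofEq_man {F : Type} [TopologicalSpace F] [CompactSpace F] [T2Space F]
    {bd : Set F} {o : SurfaceOrientation F} {P : LinkProjection F bd o} {X : Type u}
    [TopologicalSpace X] {x₀ : X} {K : EilenbergMacLaneOne X x₀ (Multiplicative (H1F2 F))}
    (κ : Coloring P K) {ρ ρ' : Fin P.n → Bool} (h : ρ = ρ') (p : P.smoothing ρ) :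
    ((XHomeo.ofEq (congrArg κ.man h)).toHomeo p : P.smoothing ρ').1 = p.1 := by
  subst h
  rfl

/-! ### Complementary smoothings and signs -/

namespace LinkDiagram

variable {F : Type} [TopologicalSpace F] {bd : Set F} {o : SurfaceOrientation F}
  (D : LinkDiagram F bd o)

/-- Complementation reverses the edges of the cube and keeps the entry that changes. -/
theorem isStep_mirror {ε ε' : Fin D.n → Bool} {j : Fin D.n} :
    D.mirror.IsStep (fun k => !ε' k) (fun k => !ε k) j ↔ D.IsStep ε ε' j := by
  change ((!ε' j) = false ∧ (!ε j) = true ∧ ∀ i, i ≠ j → (!ε i) = !ε' i) ↔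
    (ε j = false ∧ ε' j = true ∧ ∀ i, i ≠ j → ε' i = ε i)
  simp only [Bool.not_eq_false', Bool.not_eq_true', Bool.not_inj_iff]
  grind

theorem mirrorIndex_bijective (i : ℤ) :
    Function.Bijective (D.mirrorIndex : {ε : Fin D.n → Bool // D.degree ε = i} → _) := by
  constructor
  · intro ε δ h
    refine Subtype.ext (funext fun k => ?_)
    have h1 : (!ε.1 k) = !δ.1 k := congrFun (congrArg Subtype.val h) k
    simpa using h1
  · rintro ⟨δ, hδ⟩
    have h1 := D.mirror_degree fun k => !δ k
    simp only [Bool.not_not] at h1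
    refine ⟨⟨fun k => !δ k, ?_⟩, Subtype.ext (funext fun k => Bool.not_not (δ k))⟩
    have h2 : -D.degree (fun k => !δ k) = -i := h1.symm.trans hδ
    exact neg_inj.1 h2

/-- The sign relating the summand `A(D_ε)` of the complex to its dual. -/
def dualSign {n : ℕ} (ε : Fin n → Bool) : ℤˣ := ∏ i, if ε i = true then (-1) ^ (i : ℕ) else 1

theorem dualSign_step {n : ℕ} {ε ε' : Fin n → Bool} {j : Fin n} (h0 : ε j = false)
    (h1 : ε' j = true) (h : ∀ i, i ≠ j → ε' i = ε i) :
    dualSign ε' = (-1) ^ (j : ℕ) * dualSign ε := by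
  unfold dualSign
  rw [← Finset.mul_prod_erase _ _ (Finset.mem_univ j), ← Finset.mul_prod_erase _
    (fun i => if ε i = true then (-1 : ℤˣ) ^ (i : ℕ) else 1) (Finset.mem_univ j), h0, h1]
  simp only [if_true, Bool.false_eq_true, if_false, one_mul]
  congr 1
  refine Finset.prod_congr rfl fun i hi => ?_
  rw [h i (Finset.ne_of_mem_erase hi)]

/-- Positions are counted from zero, so exactly `j` entries stand in front of the `j`-th, and each
of them is `1` in exactly one of `ε` and its complement. -/
theorem card_add_card_not {n : ℕ} (ε : Fin n → Bool) (j : Fin n) :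
    (Finset.univ.filter fun i => i < j ∧ ε i = true).card +
      (Finset.univ.filter fun i => i < j ∧ (!ε i) = true).card = j := by
  have h := Finset.card_filter_add_card_filter_not (s := Finset.Iio j) (fun i => ε i = true)
  rw [Fin.card_Iio] at h
  convert h using 3
  · ext i
    simp
  · ext i
    simp

/-- This is the compatibility that dictates `dualSign`. If `l` and `l'` are the two exponents, then
`l + l' = j`, so the factor `(-1)^j` by which `dualSign` changes turns `(-1)^l` into `(-1)^{l'}`. -/
theorem dualSign_mul_step {n : ℕ} {ε ε' : Fin n → Bool} {j : Fin n} (h0 : ε j = false)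
    (h1 : ε' j = true) (h : ∀ i, i ≠ j → ε' i = ε i) (R : Type v) [CommRing R] :
    ((dualSign ε' : ℤ) : R) * (-1) ^ (Finset.univ.filter fun i => i < j ∧ ε i = true).card =
      ((dualSign ε : ℤ) : R) *
        (-1) ^ (Finset.univ.filter fun i => i < j ∧ (!ε' i) = true).card := by
  -- In front of `j` the sequences `ε` and `ε'` agree, so the count for the reversed edge can be
  -- made with the complement of `ε`.
  have h2 : (Finset.univ.filter fun i => i < j ∧ (!ε' i) = true) =
      Finset.univ.filter fun i => i < j ∧ (!ε i) = true := by
    refine Finset.filter_congr fun i _ => ?_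
    refine and_congr_right fun hi => ?_
    rw [h i hi.ne]
  rw [h2, dualSign_step h0 h1 h, ← card_add_card_not ε j]
  push_cast
  rw [pow_add, mul_comm, ← mul_assoc, ← mul_assoc, ← pow_add, ← two_mul, pow_mul]
  simp [mul_comm]

/-! ### The duality isomorphism -/

section

variable [CompactSpace F] [T2Space F] {X : Type u} [TopologicalSpace X] {x₀ : X}
  {K : EilenbergMacLaneOne X x₀ (Multiplicative (H1F2 F))} (κ : Coloring D.toLinkProjection K)
  {R : Type v} [CommRing R] (Q : HQFT.{u, v, w} X x₀ R)

/-- The saddle of the mirror image is the reversed saddle. -/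
theorem τ_mirror_edgeCob {ε ε' : Fin D.n → Bool} {j : Fin D.n} (h : D.IsStep ε ε' j)
    (h' : D.mirror.IsStep (fun k => !ε' k) (fun k => !ε k) j)
    (a : Q.A (D.mirror.smoothingMan κ fun k => !ε' k)) :
    Q.map (D.mirrorHomeo κ ε) (Q.τ (D.mirror.edgeCob κ h') a) =
      Q.τ (D.edgeCob κ h).flip (Q.map (D.mirrorHomeo κ ε') a) := by
  -- The required homeomorphism is time reversal on `F × [0,1]`. It respects the characteristic maps
  -- because these depend on the point of `F` alone.
  have hmem : ∀ x : F × I, x ∈ D.trace (D.mirror.resolution fun k => !ε' k) j ↔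
      ((Homeomorph.refl F).prodCongr unitInterval.symmHomeomorph) x ∈
        D.trace (D.resolution ε) j := by
    rintro ⟨q, t⟩
    rw [D.mirror_resolution]
    exact D.mem_trace_symm (by simp [resolution, h.1, h.2.1])
      (fun i hi => by simp [resolution, h.2.2 i hi]) q t
  refine (Q.τ_natural (D.mirror.edgeCob κ h') (D.edgeCob κ h).flip (D.mirrorHomeo κ ε')
    (D.mirrorHomeo κ ε)
    (((Homeomorph.refl F).prodCongr unitInterval.symmHomeomorph).subtype hmem)
    ?_ ?_ (fun _ => rfl) a).symm
  · intro p
    exact Subtype.ext (Prod.ext (κ.coe_ofEq_man (D.mirror_resolution ε') p).symm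
      unitInterval.symm_zero)
  · intro p
    exact Subtype.ext (Prod.ext (κ.coe_ofEq_man (D.mirror_resolution ε) p).symm
      unitInterval.symm_one)

/-- The matrix entries of the two complexes are adjoint to each other, up to sign. -/
theorem pairing_entry (ε ε' : Fin D.n → Bool) (a : Q.A (D.smoothingMan κ ε))
    (b : Q.A (D.mirror.smoothingMan κ fun k => !ε' k)) :
    ((dualSign ε' : ℤ) : R) *
        Q.pairing _ (D.entry κ Q ε ε' a) (Q.map (D.mirrorHomeo κ ε') b) =
      ((dualSign ε : ℤ) : R) * Q.pairing _ a
        (Q.map (D.mirrorHomeo κ ε) (D.mirror.entry κ Q (fun k => !ε' k) (fun k => !ε k) b)) := by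
  unfold entry
  rw [LinearMap.sum_apply, LinearMap.sum_apply, map_sum, map_sum, map_sum, LinearMap.sum_apply,
    Finset.mul_sum, Finset.mul_sum]
  -- The two sums match term by term: `j` leads from `ε` to `ε'` exactly if it leads back between
  -- the complements. For such a `j` the sign identity, the adjunction and the reversed saddle are
  -- combined.
  refine Finset.sum_congr rfl fun j _ => ?_
  by_cases h : D.IsStep ε ε' j
  · have h' := D.isStep_mirror.2 h
    rw [dif_pos h, dif_pos h']
    simp only [LinearMap.smul_apply, map_smul, smul_eq_mul]
    rw [← mul_assoc, dualSign_mul_step h.1 h.2.1 h.2.2, HQFT.pairing_τ_flip,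
      D.τ_mirror_edgeCob κ Q h h', mul_assoc]
    rfl
  · rw [dif_neg h, dif_neg (mt D.isStep_mirror.1 h)]
    simp

/-- The signed Frobenius pairings, from the complex of `D` to the dual of the complex of its
mirror image. -/
noncomputable def dualityMap (i : ℤ) :
    (D.complex κ Q).C i →ₗ[R] Module.Dual R ((D.mirror.complex κ Q).C (-i)) :=
  ∑ ε : {ε : Fin D.n → Bool // D.degree ε = i}, ((dualSign ε.1 : ℤ) : R) •
    ((Q.pairing (D.smoothingMan κ ε.1)).compl₁₂ (LinearMap.proj ε)
      ((Q.map (D.mirrorHomeo κ ε.1)).toLinearMap ∘ₗ LinearMap.proj (D.mirrorIndex ε)))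

theorem dualityMap_apply (i : ℤ) (x : (D.complex κ Q).C i) (y : (D.mirror.complex κ Q).C (-i)) :
    D.dualityMap κ Q i x y = ∑ ε : {ε : Fin D.n → Bool // D.degree ε = i},
      ((dualSign ε.1 : ℤ) : R) * Q.pairing (D.smoothingMan κ ε.1) (x ε)
        (Q.map (D.mirrorHomeo κ ε.1) (y (D.mirrorIndex ε))) := by
  unfold dualityMap
  rw [LinearMap.sum_apply, LinearMap.sum_apply]
  rfl

-- The complementation of indices is injective, so a vector supported on one summand of the mirror
-- complex meets only one of the signed pairings. This reduces bijectivity to the single summands.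
open Classical in
theorem dualityMap_single (i : ℤ)
    (x : ∀ ε : {ε : Fin D.n → Bool // D.degree ε = i}, Q.A (D.smoothingMan κ ε.1))
    (ε : {ε : Fin D.n → Bool // D.degree ε = i})
    (b : Q.A (D.mirror.smoothingMan κ fun k => !ε.1 k)) :
    D.dualityMap κ Q i x (Pi.single (D.mirrorIndex ε) b) =
      ((dualSign ε.1 : ℤ) : R) * Q.pairing (D.smoothingMan κ ε.1) (x ε)
        (Q.map (D.mirrorHomeo κ ε.1) b) := by
  let A : {δ : Fin D.mirror.n → Bool // D.mirror.degree δ = -i} → Type w :=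
    fun δ => Q.A (D.mirror.smoothingMan κ δ.1)
  refine (D.dualityMap_apply κ Q i x _).trans
    ((Finset.sum_eq_single ε (fun δ _ hδ => ?_) fun h => absurd (Finset.mem_univ ε) h).trans ?_)
  · refine (congrArg (fun v => ((dualSign δ.1 : ℤ) : R) * Q.pairing (D.smoothingMan κ δ.1) (x δ)
      (Q.map (D.mirrorHomeo κ δ.1) v))
      (Pi.single_eq_of_ne (M := A) ((D.mirrorIndex_bijective i).injective.ne hδ) b)).trans ?_
    exact (((dualSign δ.1 : ℤ) : R) • Q.pairing (D.smoothingMan κ δ.1) (x δ) ∘ₗ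
      (Q.map (D.mirrorHomeo κ δ.1)).toLinearMap).map_zero
  · exact congrArg (fun v => ((dualSign ε.1 : ℤ) : R) * Q.pairing (D.smoothingMan κ ε.1) (x ε)
      (Q.map (D.mirrorHomeo κ ε.1) v)) (Pi.single_eq_same (M := A) (D.mirrorIndex ε) b)

theorem dualSign_mul_self {n : ℕ} (ε : Fin n → Bool) (R : Type v) [CommRing R] :
    ((dualSign ε : ℤ) : R) * ((dualSign ε : ℤ) : R) = 1 := by
  rw [← Int.cast_mul, ← Units.val_mul, Int.units_mul_self, Units.val_one, Int.cast_one]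

/-- Complementation matches the summands of the two complexes bijectively, and on matched summands
the map is a perfect pairing times a sign. -/
theorem dualityMap_bijective (i : ℤ) : Function.Bijective (D.dualityMap κ Q i) := by
  classical
  constructor
  · rw [injective_iff_map_eq_zero]
    intro (x : ∀ ε : {ε : Fin D.n → Bool // D.degree ε = i}, Q.A (D.smoothingMan κ ε.1)) hx
    funext ε
    refine (injective_iff_map_eq_zero _).1 (Q.pairing_bijective (D.smoothingMan κ ε.1)).injective
      _ (LinearMap.ext fun v => ?_)
    have h : ((dualSign ε.1 : ℤ) : R) * Q.pairing _ (x ε)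
        (Q.map (D.mirrorHomeo κ ε.1) ((Q.map (D.mirrorHomeo κ ε.1)).symm v)) = 0 :=
      (D.dualityMap_single κ Q i x ε _).symm.trans (LinearMap.congr_fun hx _)
    rw [LinearEquiv.apply_symm_apply] at h
    rw [LinearMap.zero_apply, ← one_mul (Q.pairing _ (x ε) v), ← dualSign_mul_self ε.1 R,
      mul_assoc, h, mul_zero]
  · intro φ
    -- On each summand `φ` restricts to a linear form, transported to `A(D_ε)`; perfectness
    -- represents it by a vector. The sign is put in here so that it cancels against its own copy in
    -- `dualityMap`.
    choose x hx using fun ε : {ε : Fin D.n → Bool // D.degree ε = i} =>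
      (Q.pairing_bijective (D.smoothingMan κ ε.1)).surjective
        (((dualSign ε.1 : ℤ) : R) • (φ ∘ₗ LinearMap.single R
          (fun δ : {δ : Fin D.mirror.n → Bool // D.mirror.degree δ = -i} =>
            Q.A (D.mirror.smoothingMan κ δ.1)) (D.mirrorIndex ε) ∘ₗ
          (Q.map (D.mirrorHomeo κ ε.1)).symm.toLinearMap))
    refine ⟨x, LinearMap.pi_ext fun δ b => ?_⟩
    obtain ⟨ε, rfl⟩ := (D.mirrorIndex_bijective i).surjective δ
    refine (D.dualityMap_single κ Q i x ε b).trans ?_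
    rw [hx, LinearMap.smul_apply, smul_eq_mul, ← mul_assoc, dualSign_mul_self, one_mul]
    exact congrArg (fun v => φ (Pi.single (D.mirrorIndex ε) v))
      ((Q.map (D.mirrorHomeo κ ε.1)).symm_apply_apply b)

/-- Both sides expand into double sums over pairs `(ε, ε')` of signed pairings of matrix entries,
and these agree pair by pair by `pairing_entry`. -/
theorem dualityMap_comm (i j : ℤ) (x : (D.complex κ Q).C i)
    (y : (D.mirror.complex κ Q).C (-j)) :
    D.dualityMap κ Q j ((D.complex κ Q).d i j x) y =
      D.dualityMap κ Q i x ((D.mirror.complex κ Q).d (-j) (-i) y) := by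
  have hd : ∀ ε', (D.complex κ Q).d i j x ε' =
      ∑ ε : {ε : Fin D.n → Bool // D.degree ε = i}, D.entry κ Q ε.1 ε'.1 (x ε) := by
    intro ε'
    exact LinearMap.sum_apply _ _ _
  have hd' : ∀ ε : {ε : Fin D.n → Bool // D.degree ε = i},
      (D.mirror.complex κ Q).d (-j) (-i) y (D.mirrorIndex ε) =
        ∑ ε' : {ε : Fin D.n → Bool // D.degree ε = j},
          D.mirror.entry κ Q (fun k => !ε'.1 k) (fun k => !ε.1 k) (y (D.mirrorIndex ε')) := by
    intro ε
    refine (LinearMap.sum_apply _ _ _).trans ?_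
    -- The differential of the mirror complex sums over smoothings of `D^!`; complementation
    -- reindexes this sum by smoothings of `D`.
    exact ((Equiv.ofBijective _ (D.mirrorIndex_bijective j)).sum_comp
      fun δ => D.mirror.entry κ Q δ.1 (fun k => !ε.1 k) (y δ)).symm
  rw [dualityMap_apply, dualityMap_apply]
  simp only [hd, hd', map_sum, LinearMap.sum_apply, Finset.mul_sum]
  rw [Finset.sum_comm]
  exact Finset.sum_congr rfl fun ε _ => Finset.sum_congr rfl fun ε' _ =>
    D.pairing_entry κ Q ε.1 ε'.1 (x ε) (y (D.mirrorIndex ε'))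

end

end LinkDiagram

theorem theorem1p2 {F : Type} [TopologicalSpace F] [CompactSpace F] [T2Space F] {bd : Set F}
    (hF : IsSurface F bd) {o : SurfaceOrientation F} (D : LinkDiagram F bd o)
    {X : Type u} [TopologicalSpace X] {x₀ : X}
    {K : EilenbergMacLaneOne X x₀ (Multiplicative (H1F2 F))}
    (κ : Coloring D.toLinkProjection K)
    {R : Type v} [CommRing R] (Q : HQFT.{u, v, w} X x₀ R) :
    ∃ Ψ : ModuleComplex.Iso (D.complex κ Q) (D.mirror.complex κ Q).dual,
      ∃ s : (Fin D.n → Bool) → ℤˣ, ∀ (i : ℤ) (x : (D.complex κ Q).C i)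
        (y : (D.mirror.complex κ Q).C (-i)),
        (D.mirror.complex κ Q).dualValue (Ψ.equiv i x) y =
          ∑ ε : {ε : Fin D.n → Bool // D.degree ε = i}, ((s ε.1 : ℤ) : R) *
            Q.pairing (D.smoothingMan κ ε.1) (x ε)
              (Q.map (D.mirrorHomeo κ ε.1) (y (D.mirrorIndex ε))) := by
  -- The differential of the dual complex is a transpose, so commutation with the differentials,
  -- tested on an element `y`, is precisely the adjunction `dualityMap_comm`.
  exact ⟨⟨fun i => LinearEquiv.ofBijective (D.dualityMap κ Q i) (D.dualityMap_bijective κ Q i),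
    fun i j _ x => LinearMap.ext fun y => D.dualityMap_comm κ Q i j x y⟩,
    LinkDiagram.dualSign, fun i x y => D.dualityMap_apply κ Q i x y⟩
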